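/- Let $n\ge 1$, let $0<q<\infty$, $0<p,p_0,p_1\le\infty$, $0<\theta<1$ and $s,s_0,s_1\in\mathbb{R}$. Let $\psi:\mathbb{R}^n\to\mathbb{R}$ be a smooth cut-off function, supported in $\{|\xi|\le 2\}$ and equal to $1$ in a neighbourhood of the origin. Put $\varphi(\xi)=\psi(\xi)-\psi(2\xi)$, $\varphi_k(\xi)=\varphi(2^{-k}\xi)$ and $\Delta_k=\mathcal F^{-1}\varphi_k\mathcal F$ for $k\in\mathbb{Z}$, and for a tempered distribution $u$ on $\mathbb{R}^n$ and $\sigma\in\mathbb{R}$, $0<r\le\infty$, $0<t\le\infty$ let $$\|u\|_{\dot B^{\sigma}_{r,t}}=\Big(\sum_{k\in\mathbb{Z}}2^{k\sigma t}\|\Delta_k u\|_{L^r(\mathbb{R}^n)}^{t}\Big)^{1/t}\in[0,\infty]$$ (with the supremum $\sup_{k}2^{k\sigma}\|\Delta_ku\|_{L^r}$ if $t=\infty$, and $\|\Delta_k u\|_{L^r}=\infty$ if $\Delta_k u\notin L^r$); $u$ belongs to $\dot B^{\sigma}_{r,t}$ if this is finite. (These quantities vanish on polynomials, so they depend only on $u$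 modulo polynomials.) Then the following are equivalent, with the convention $n/\infty=0$. (A) There is a constant $C<\infty$ such that for all $u\in\dot B^{s_0}_{p_0,\infty}\cap\dot B^{s_1}_{p_1,\infty}$ $$\|u\|_{\dot B^{s}_{p,q}}\le C\,\|u\|_{\dot B^{s_0}_{p_0,\infty}}^{1-\theta}\,\|u\|_{\dot B^{s_1}_{p_1,\infty}}^{\theta}.$$ (B) All of the following four conditions hold: $$\frac np-s=(1-\theta)\Big(\frac n{p_0}-s_0\Big)+\theta\Big(\frac n{p_1}-s_1\Big),$$ $$s_0-\frac n{p_0}\ne s_1-\frac n{p_1},$$ $$s\le(1-\theta)s_0+\theta s_1,$$ $$p_0=p_1\quad\text{if}\quad s=(1-\theta)s_0+\theta s_1.$$ -/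

import Mathlib

open MeasureTheory
open scoped ENNReal NNReal SchwartzMap

noncomputable section

namespace Besov

/-- A smooth cut-off function on `ℝⁿ` supported in the ball `|ξ| ≤ 2`; as usual for a cut-off
function, it is identically `1` near the origin. -/
structure IsCutoff {n : ℕ} (ψ : EuclideanSpace ℝ (Fin n) → ℝ) : Prop where
  smooth : ContDiff ℝ (⊤ : ℕ∞) ψ
  tsupport_subset : tsupport ψ ⊆ Metric.closedBall 0 2
  eq_one_near_zero : ∀ᶠ ξ in nhds (0 : EuclideanSpace ℝ (Fin n)), ψ ξ = 1

/-- `φ_k(ξ) = φ(2⁻ᵏ ξ)`, where `φ(ξ) = ψ(ξ) - ψ(2 ξ)`. -/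
def dyadicSymbol {n : ℕ} (ψ : EuclideanSpace ℝ (Fin n) → ℝ) (k : ℤ)
    (ξ : EuclideanSpace ℝ (Fin n)) : ℝ :=
  ψ ((2 : ℝ) ^ (-k) • ξ) - ψ ((2 : ℝ) • ((2 : ℝ) ^ (-k) • ξ))

/-- The dyadic operator `Δ_k = 𝓕⁻¹ φ_k 𝓕`, acting on tempered distributions. -/
def dyadicBlock {n : ℕ} (ψ : EuclideanSpace ℝ (Fin n) → ℝ) (k : ℤ)
    (u : 𝓢'(EuclideanSpace ℝ (Fin n), ℂ)) : 𝓢'(EuclideanSpace ℝ (Fin n), ℂ) :=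
  TemperedDistribution.fourierMultiplierCLM ℂ (fun ξ => (dyadicSymbol ψ k ξ : ℂ)) u

/-- The tempered distribution `T` is given by integration against the function `g`. -/
def IsRepresentedBy {n : ℕ} (T : 𝓢'(EuclideanSpace ℝ (Fin n), ℂ))
    (g : EuclideanSpace ℝ (Fin n) → ℂ) : Prop :=
  LocallyIntegrable g volume ∧
    ∀ f : 𝓢(EuclideanSpace ℝ (Fin n), ℂ),
      Integrable (fun x => f x * g x) volume ∧ T f = ∫ x, f x * g x

/-- The `L^p` (quasi-)norm, `0 < p ≤ ∞`, of a tempered distribution, with values in `[0, ∞]`: the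
`L^p` (quasi-)norm of the function that represents it (unique up to null sets), and `∞` if the
distribution is not a function. -/
def lpNorm {n : ℕ} (p : ℝ≥0∞) (T : 𝓢'(EuclideanSpace ℝ (Fin n), ℂ)) : ℝ≥0∞ :=
  ⨅ (g : EuclideanSpace ℝ (Fin n) → ℂ) (_ : IsRepresentedBy T g), eLpNorm g p volume

/-- The homogeneous Besov (quasi-)norm `‖u‖_{Ḃ^s_{p,q}}`, `0 < p, q ≤ ∞`, of a tempered
distribution, with values in `[0, ∞]`: the `ℓ^q(ℤ)` (quasi-)norm of `2^{ks} ‖Δ_k u‖_p`. -/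
def besovNorm {n : ℕ} (ψ : EuclideanSpace ℝ (Fin n) → ℝ) (s : ℝ) (p q : ℝ≥0∞)
    (u : 𝓢'(EuclideanSpace ℝ (Fin n), ℂ)) : ℝ≥0∞ :=
  if q = ∞ then
    ⨆ k : ℤ, (2 : ℝ≥0∞) ^ ((k : ℝ) * s) * lpNorm p (dyadicBlock ψ k u)
  else
    (∑' k : ℤ, ((2 : ℝ≥0∞) ^ ((k : ℝ) * s) * lpNorm p (dyadicBlock ψ k u)) ^ q.toReal)
      ^ (1 / q.toReal)

/-- Membership in the homogeneous Besov space `Ḃ^s_{p,q}`. All `Δ_k` vanish on polynomials, so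
this and the norm depend only on the class of `u` modulo polynomials. -/
def MemBesov {n : ℕ} (ψ : EuclideanSpace ℝ (Fin n) → ℝ) (s : ℝ) (p q : ℝ≥0∞)
    (u : 𝓢'(EuclideanSpace ℝ (Fin n), ℂ)) : Prop :=
  besovNorm ψ s p q u < ∞

end Besov

end

/-! Sufficiency. Write N₀, N₁ for the two endpoint norms. Since Δ_k u has spectrum in a ball of
radius 2 · 2^k, Hölder between p₀ and p₁ at a parameter τ, followed by Nikolskii's inequality
(`exists_eLpNorm_top_dyadicBlock_le`), bounds 2^{ks}‖Δ_k u‖_p by N₀^{1-τ} N₁^τ times 2^k to the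
power of the scaling defect at τ (`exists_dyadicBlock_bound`). This needs 1/p ≤ (1-τ)/p₀ + τ/p₁. The
defect vanishes at τ = θ by the first condition and is ±εD at θ ± ε, with D ≠ 0 by the second. The
two resulting geometric bounds decay on either side of the k where they cross, so the ℓ^q sum is
controlled by their common value N₀^{1-θ} N₁^θ (`exists_tsum_rpow_le_of_two_bounds`). Given the
first condition, the third says 1/p ≤ (1-θ)/p₀ + θ/p₁: strict inequality leaves room for ε, and in
case of equality p₀ = p₁ removes the dependence on τ.

Necessity. Test on finite sums of wave packets with lacunary frequencies and free amplitudes and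
widths. Every Δ_k sees at most one packet, so the endpoint norms are bounded by a maximum of
explicit powers of two, while the left side is bounded below by an ℓ^q sum of such powers; (A)
becomes an inequality between exponents (`exists_exponent_bound`). A single packet of varying
frequency or width forces the first and third conditions. If the second or fourth fails, N packets
can be normalised in all three norms at once, and N^{1/q} ≤ C is absurd for q < ∞
(`conditions_of_exponent_bound`). -/

noncomputable section

open scoped FourierTransform RealInnerProductSpace Topology

namespace Besov

/-! ### Fourier inversion and reproducing kernels for integrable functions. -/

section Fourier

variable {V : Type*} [NormedAddCommGroup V] [InnerProductSpace ℝ V] [FiniteDimensional ℝ V]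
  [MeasurableSpace V] [BorelSpace V]

theorem integral_fourier_mul_eq_flip {f g : V → ℂ} (hf : Integrable f) (hg : Integrable g) :
    ∫ ξ, 𝓕 f ξ * g ξ = ∫ x, f x * 𝓕 g x := by
  have := VectorFourier.integral_fourierIntegral_smul_eq_flip (e := 𝐞) (L := innerₗ V)
    (μ := volume) (ν := volume) Real.continuous_fourierChar continuous_inner hf hg
  simpa using! this

/-- Moving the transform from f onto the modulated multiplier turns the product into a convolution;
only integrability is used. -/
theorem fourierInv_mul_fourier {f m : V → ℂ} (hf : Integrable f) (hm : Integrable m) (x : V) :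
    𝓕⁻ (fun ξ => m ξ * 𝓕 f ξ) x = ∫ y, f y * 𝓕⁻ m (x - y) := by
  have hint : Integrable (fun ξ => 𝐞 ⟪ξ, x⟫ • m ξ) := by
    have := (Real.fourierIntegral_convergent_iff (f := m) (-x)).2 hm
    simpa using this
  have h := integral_fourier_mul_eq_flip hf hint
  rw [Real.fourierInv_eq]
  calc ∫ ξ, 𝐞 ⟪ξ, x⟫ • (m ξ * 𝓕 f ξ) = ∫ ξ, 𝓕 f ξ * (𝐞 ⟪ξ, x⟫ • m ξ) := by
        congr 1 with ξ
        simp only [Circle.smul_def, smul_eq_mul]; ring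
    _ = _ := h
    _ = _ := by
        congr 1 with y
        rw [Real.fourier_eq, Real.fourierInv_eq]
        congr 2 with ξ
        rw [inner_sub_right, sub_eq_add_neg, AddChar.map_add_eq_mul, mul_comm, mul_smul]

/-- Used with v = 0 for the dyadic dilations of kernels, and with general v for wave packets. -/
theorem fourierInv_comp_smul_sub (m : V → ℂ) {c : ℝ} (hc : c ≠ 0) (v x : V) :
    𝓕⁻ (fun ξ => m (c • (ξ - v))) x =
      𝐞 ⟪v, x⟫ • (|(c ^ Module.finrank ℝ V)⁻¹| • 𝓕⁻ m (c⁻¹ • x)) := by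
  rw [Real.fourierInv_eq, Real.fourierInv_eq]
  have h1 : ∫ ξ, 𝐞 ⟪ξ, x⟫ • m (c • (ξ - v)) = ∫ ξ, 𝐞 ⟪ξ + v, x⟫ • m (c • ξ) := by
    rw [← integral_sub_right_eq_self (fun ξ => 𝐞 ⟪ξ + v, x⟫ • m (c • ξ)) v]
    simp
  have h2 : ∫ ξ, 𝐞 ⟪ξ + v, x⟫ • m (c • ξ) = 𝐞 ⟪v, x⟫ • ∫ ξ, 𝐞 ⟪ξ, x⟫ • m (c • ξ) := by
    rw [Circle.smul_def, ← integral_smul]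
    congr 1 with ξ
    rw [inner_add_left, AddChar.map_add_eq_mul, mul_comm, mul_smul, Circle.smul_def]
  rw [h1, h2, ← Measure.integral_comp_smul volume (fun ξ => 𝐞 ⟪ξ, c⁻¹ • x⟫ • m ξ) c]
  congr 2 with ξ
  rw [inner_smul_left, inner_smul_right]
  simp [hc]

theorem norm_fourier_le_integral (f : V → ℂ) (ξ : V) : ‖𝓕 f ξ‖ ≤ ∫ x, ‖f x‖ :=
  VectorFourier.norm_fourierIntegral_le_integral_norm _ _ _ _ _

theorem continuous_fourier {f : V → ℂ} (hf : Integrable f) : Continuous (𝓕 f) :=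
  VectorFourier.fourierIntegral_continuous Real.continuous_fourierChar continuous_inner hf

/-- Integration against Schwartz functions determines a locally integrable function. -/
theorem ae_eq_of_integral_schwartz_mul_eq {f g : V → ℂ} (hf : LocallyIntegrable f)
    (hg : LocallyIntegrable g) (h : ∀ w : 𝓢(V, ℂ), ∫ x, w x * f x = ∫ x, w x * g x) :
    f =ᵐ[volume] g := by
  refine ae_eq_of_integral_contDiff_smul_eq hf hg fun w hw hw' => ?_
  have hc : HasCompactSupport (fun x => (w x : ℂ)) :=
    hw'.comp_left (g := fun t : ℝ => (t : ℂ)) (by simp)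
  have hd : ContDiff ℝ (⊤ : ℕ∞) (fun x => (w x : ℂ)) := Complex.ofRealCLM.contDiff.comp hw
  simpa using h (hc.toSchwartzMap hd)

/-- An integrable function is recovered from its Fourier transform. -/
theorem ae_eq_fourierInv_fourier {f : V → ℂ} (hf : Integrable f) (hf' : Integrable (𝓕 f)) :
    f =ᵐ[volume] 𝓕⁻ (𝓕 f) := by
  have hcont : Continuous (𝓕⁻ (𝓕 f)) := by
    have := continuous_fourier hf'
    have h2 : 𝓕⁻ (𝓕 f) = fun x => 𝓕 (𝓕 f) (-x) := by
      ext x; rw [Real.fourierInv_eq_fourier_neg]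
    rw [h2]; exact this.comp continuous_neg
  -- Inversion is proved weakly: a test function is written as 𝓕(𝓕⁻ w) and the transform is flipped
  -- twice, so f need not be continuous.
  refine ae_eq_of_integral_schwartz_mul_eq hf.locallyIntegrable hcont.locallyIntegrable
    fun w => ?_
  have h1 := integral_fourier_mul_eq_flip hf ((𝓕⁻ w).integrable (μ := volume))
  rw [← SchwartzMap.fourier_coe, FourierTransform.fourier_fourierInv_eq] at h1
  have hw : Integrable (fun x => w (-x)) := (w.integrable (μ := volume)).comp_neg
  have h2 := integral_fourier_mul_eq_flip hf' hw
  calc ∫ x, w x * f x = ∫ x, f x * w x := by simp_rw [mul_comm]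
    _ = ∫ ξ, 𝓕 f ξ * (𝓕⁻ w) ξ := h1.symm
    _ = ∫ ξ, 𝓕 f ξ * 𝓕 (fun x => w (-x)) ξ := by
        rw [SchwartzMap.fourierInv_coe, Real.fourierInv_eq_fourier_comp_neg]
    _ = ∫ x, 𝓕 (𝓕 f) x * w (-x) := h2.symm
    _ = ∫ x, 𝓕 (𝓕 f) (-x) * w x := by
        rw [← integral_neg_eq_self]; simp
    _ = _ := by
        congr 1 with x
        rw [Real.fourierInv_eq_fourier_neg, mul_comm]

/-- A kernel whose Fourier transform is `1` on the spectrum reproduces the function. -/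
theorem ae_eq_integral_mul_kernel {f m : V → ℂ} (hf : Integrable f) (hm : Integrable m)
    (hc : HasCompactSupport (𝓕 f)) (h : ∀ ξ, 𝓕 f ξ ≠ 0 → m ξ = 1) :
    ∀ᵐ x, f x = ∫ y, f y * 𝓕⁻ m (x - y) := by
  have hf' : Integrable (𝓕 f) := (continuous_fourier hf).integrable_of_hasCompactSupport hc
  filter_upwards [ae_eq_fourierInv_fourier hf hf'] with x hx
  rw [hx, ← fourierInv_mul_fourier hf hm]
  refine congrArg (fun g : V → ℂ => 𝓕⁻ g x) (funext fun ξ => ?_)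
  by_cases h0 : 𝓕 f ξ = 0
  · simp [h0]
  · simp [h ξ h0]

end Fourier

/-! ### From a reproducing kernel to L^r–L^∞ bounds. -/

section Kernel

/-- Hölder applied to the splitting f K = (f K^{1/r}) · K^{1/r'}. -/
theorem lintegral_mul_kernel_rpow_le {V : Type*} [MeasurableSpace V] {μ : Measure V}
    {f K : V → ℝ≥0∞} (hf : AEMeasurable f μ)
    (hK : AEMeasurable K μ) {r : ℝ} (hr1 : 1 ≤ r) :
    (∫⁻ y, f y * K y ∂μ) ^ r ≤ (∫⁻ y, f y ^ r * K y ∂μ) * (∫⁻ y, K y ∂μ) ^ (r - 1) := by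
  rcases hr1.eq_or_lt with rfl | hr
  · simp
  have hr0 : 0 < r := by linarith
  set r' := r.conjExponent
  have hrr : r.HolderConjugate r' := Real.HolderConjugate.conjExponent hr
  have h := ENNReal.lintegral_mul_le_Lp_mul_Lq μ hrr
    (hf.mul (hK.pow_const (1 / r))) (hK.pow_const (1 / r'))
  have h1 : ∀ y, (f * fun y => K y ^ (1 / r)) y * K y ^ (1 / r') = f y * K y := fun y => by
    simp only [Pi.mul_apply]
    rw [mul_assoc, ← ENNReal.rpow_add_of_nonneg _ _ hrr.one_div_nonneg hrr.symm.one_div_nonneg]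
    have : 1 / r + 1 / r' = 1 := by simpa using hrr.inv_add_inv_eq_one
    rw [this, ENNReal.rpow_one]
  simp only [Pi.mul_apply] at h h1
  simp only [h1] at h
  calc _ ≤ _ := ENNReal.rpow_le_rpow h hr0.le
    _ = _ := by
      rw [ENNReal.mul_rpow_of_nonneg _ _ hr0.le, ← ENNReal.rpow_mul, ← ENNReal.rpow_mul]
      have e1 : 1 / r * r = 1 := by field_simp
      have e2 : 1 / r' * r = r - 1 := by
        have := hrr.sub_one_mul_conj
        have h' := hrr.symm.ne_zero
        field_simp
        linarith
      have e3 : 1 / r' * r' = 1 := one_div_mul_cancel hrr.symm.ne_zero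
      rw [e1, e2, ENNReal.rpow_one]
      simp only [ENNReal.mul_rpow_of_nonneg _ _ hr0.le, ← ENNReal.rpow_mul, e1, e3,
        ENNReal.rpow_one]

variable {V : Type*} [NormedAddCommGroup V] [MeasurableSpace V] [BorelSpace V]
  {μ : Measure V} [μ.IsAddLeftInvariant] [μ.IsNegInvariant]

/-- With M the supremum, |f| ≤ M^{1-r}|f|^r under the integral gives M ≤ M^{1-r} A ∫|f|^r, and
M^{1-r} is divided out. The L¹ hypothesis serves only to make M finite, which the division requires.
-/
theorem eLpNorm_top_le_of_kernel_of_le_one {V : Type*} [AddGroup V]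
    [MeasurableSpace V] {μ : Measure V} {f K : V → ℂ} (hf1 : eLpNorm f 1 μ ≠ ∞) {A : ℝ≥0}
    (h : ∀ᵐ x ∂μ, ‖f x‖ₑ ≤ ∫⁻ y, ‖f y‖ₑ * ‖K (x - y)‖ₑ ∂μ) (hA : ∀ x, ‖K x‖ₑ ≤ A)
    {r : ℝ} (hr : 0 < r) (hr1 : r ≤ 1) :
    eLpNorm f ∞ μ ^ r ≤ A * ∫⁻ x, ‖f x‖ₑ ^ r ∂μ := by
  set M := eLpNorm f ∞ μ with hM
  have hMae : ∀ᵐ x ∂μ, ‖f x‖ₑ ≤ M := by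
    rw [hM, eLpNorm_exponent_top]; exact enorm_ae_le_eLpNormEssSup f μ
  have hle : ∀ c : ℝ≥0∞, (∀ᵐ x ∂μ, ‖f x‖ₑ ≤ c) → M ≤ c := fun c hc => by
    rw [hM, eLpNorm_exponent_top]; exact essSup_le_of_ae_le c hc
  have hMtop : M ≠ ∞ := by
    refine ne_top_of_le_ne_top (b := A * eLpNorm f 1 μ) (by finiteness) (hle _ ?_)
    filter_upwards [h] with x hx
    refine hx.trans ?_
    rw [eLpNorm_one_eq_lintegral_enorm, mul_comm (A : ℝ≥0∞), ← lintegral_mul_const' _ _ (by simp)]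
    gcongr with y
    exact hA _
  rcases eq_or_ne M 0 with h0 | h0
  · simp [h0, hr]
  have key : M ≤ M ^ (1 - r) * (A * ∫⁻ x, ‖f x‖ₑ ^ r ∂μ) := by
    refine hle _ ?_
    filter_upwards [h] with x hx
    refine hx.trans ?_
    rw [← mul_assoc, ← lintegral_const_mul' _ _
      (ENNReal.mul_ne_top (ENNReal.rpow_ne_top_of_nonneg (by linarith) hMtop) (by simp))]
    refine lintegral_mono_ae ?_
    filter_upwards [hMae] with y hy
    have : ‖f y‖ₑ ≤ M ^ (1 - r) * ‖f y‖ₑ ^ r := by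
      calc ‖f y‖ₑ = ‖f y‖ₑ ^ (1 - r) * ‖f y‖ₑ ^ r := by
            rw [← ENNReal.rpow_add_of_nonneg _ _ (by linarith) hr.le]; simp
        _ ≤ _ := by gcongr
    calc ‖f y‖ₑ * ‖K (x - y)‖ₑ ≤ M ^ (1 - r) * ‖f y‖ₑ ^ r * A := by
          gcongr; exact hA _
      _ = _ := by ring
  have h2 : M = M ^ (1 - r) * M ^ r := by
    rw [← ENNReal.rpow_add_of_nonneg _ _ (by linarith) hr.le]; simp
  have key' : M ^ (1 - r) * M ^ r ≤ M ^ (1 - r) * (A * ∫⁻ x, ‖f x‖ₑ ^ r ∂μ) := h2 ▸ key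
  exact (ENNReal.mul_le_mul_iff_right (by simp [h0, hMtop])
    (ENNReal.rpow_ne_top_of_nonneg (by linarith) hMtop)).1 key'

/-- Nikolskii's inequality for a function reproduced by a kernel `K`: only the supremum and the
`L¹` norm of `K` enter. -/
theorem eLpNorm_top_le_of_kernel {f K : V → ℂ} (hf : AEStronglyMeasurable f μ)
    (hf1 : eLpNorm f 1 μ ≠ ∞) {A B : ℝ≥0} (hKm : Measurable K)
    (h : ∀ᵐ x ∂μ, ‖f x‖ₑ ≤ ∫⁻ y, ‖f y‖ₑ * ‖K (x - y)‖ₑ ∂μ) (hA : ∀ x, ‖K x‖ₑ ≤ A)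
    (hB : ∫⁻ x, ‖K x‖ₑ ∂μ ≤ B) {r : ℝ≥0∞} (hr : 0 < r) :
    eLpNorm f ∞ μ ≤ (A : ℝ≥0∞) ^ (r⁻¹).toReal * ((1 + B : ℝ≥0) : ℝ≥0∞) * eLpNorm f r μ := by
  -- With 1 + B ≥ 1 in place of B the constant may be raised to larger powers, so one formula covers
  -- r ≤ 1, r ≥ 1 and r = ∞.
  have hone : (1 : ℝ≥0∞) ≤ ((1 + B : ℝ≥0) : ℝ≥0∞) := by simp
  rcases eq_or_ne r ∞ with rfl | hrtop
  · simp only [ENNReal.inv_top, ENNReal.toReal_zero, ENNReal.rpow_zero, one_mul]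
    exact le_mul_of_one_le_left (by simp) hone
  have hr0 : 0 < r.toReal := ENNReal.toReal_pos hr.ne' hrtop
  have main : eLpNorm f ∞ μ ^ r.toReal ≤
      A * ((1 + B : ℝ≥0) : ℝ≥0∞) ^ r.toReal * ∫⁻ x, ‖f x‖ₑ ^ r.toReal ∂μ := by
    rcases le_total r.toReal 1 with h1 | h1
    · refine (eLpNorm_top_le_of_kernel_of_le_one hf1 h hA hr0 h1).trans ?_
      gcongr
      exact le_mul_of_one_le_right (by simp) (ENNReal.one_le_rpow hone hr0)
    · rw [← ENNReal.le_rpow_inv_iff hr0, eLpNorm_exponent_top]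
      refine essSup_le_of_ae_le _ ?_
      filter_upwards [h] with x hx
      rw [ENNReal.le_rpow_inv_iff hr0]
      have hKx : Measurable fun y => K (x - y) := 
        hKm.comp (continuous_const.sub continuous_id).measurable
      have hBx : ∫⁻ y, ‖K (x - y)‖ₑ ∂μ ≤ B := by
        rw [lintegral_sub_left_eq_self (fun y => ‖K y‖ₑ) x]; exact hB
      calc ‖f x‖ₑ ^ r.toReal ≤ (∫⁻ y, ‖f y‖ₑ * ‖K (x - y)‖ₑ ∂μ) ^ r.toReal := by gcongr
        _ ≤ _ := lintegral_mul_kernel_rpow_le hf.enorm hKx.enorm.aemeasurable h1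
        _ ≤ (∫⁻ y, ‖f y‖ₑ ^ r.toReal * A ∂μ) * ((1 + B : ℝ≥0) : ℝ≥0∞) ^ r.toReal := by
            gcongr with y
            · exact hA _
            · calc _ ≤ ((1 + B : ℝ≥0) : ℝ≥0∞) ^ (r.toReal - 1) := by
                    gcongr
                    exact hBx.trans (by simp)
                _ ≤ _ := ENNReal.rpow_le_rpow_of_exponent_le hone (by linarith)
        _ = _ := by rw [lintegral_mul_const' _ _ (by simp)]; ring
  have e : (r⁻¹).toReal = 1 / r.toReal := by simp [ENNReal.toReal_inv]
  rw [eLpNorm_eq_lintegral_rpow_enorm_toReal hr.ne' hrtop, e]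
  rw [← ENNReal.le_rpow_inv_iff hr0] at main
  refine main.trans_eq ?_
  rw [ENNReal.mul_rpow_of_nonneg _ _ (by positivity),
    ENNReal.mul_rpow_of_nonneg _ _ (by positivity),
    ← ENNReal.rpow_mul, mul_inv_cancel₀ hr0.ne', ENNReal.rpow_one, one_div]

end Kernel

/-! ### Dyadic symbols, representing functions and mollifiers. -/

section Symbol

variable {n : ℕ} {ψ : EuclideanSpace ℝ (Fin n) → ℝ}

local notation "𝔼" => EuclideanSpace ℝ (Fin n)

theorem IsCutoff.eq_zero (hψ : IsCutoff ψ) {ξ : 𝔼} (h : 2 < ‖ξ‖) : ψ ξ = 0 := by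
  by_contra h0
  have := hψ.tsupport_subset (subset_tsupport _ h0)
  simp at this
  linarith

theorem dyadicSymbol_eq_zero_of_lt (hψ : IsCutoff ψ) {k : ℤ} {ξ : 𝔼} (h : 2 * 2 ^ k < ‖ξ‖) :
    dyadicSymbol ψ k ξ = 0 := by
  have h2 : 2 < ‖(2 : ℝ) ^ (-k) • ξ‖ := by
    rw [norm_smul, Real.norm_of_nonneg (by positivity), zpow_neg, inv_mul_eq_div,
      lt_div_iff₀ (by positivity)]
    exact h
  have h3 : 2 < ‖(2 : ℝ) • (2 : ℝ) ^ (-k) • ξ‖ := by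
    rw [norm_smul, Real.norm_of_nonneg zero_le_two]; linarith
  rw [dyadicSymbol, hψ.eq_zero h2, hψ.eq_zero h3, sub_zero]

theorem contDiff_dyadicSymbol (hψ : IsCutoff ψ) (k : ℤ) :
    ContDiff ℝ (⊤ : ℕ∞) (fun ξ => (dyadicSymbol ψ k ξ : ℂ)) := by
  have h := hψ.smooth
  refine Complex.ofRealCLM.contDiff.comp (ContDiff.sub ?_ ?_)
  · exact h.comp (contDiff_id.const_smul _)
  · exact h.comp ((contDiff_id.const_smul _).const_smul _)

theorem hasCompactSupport_dyadicSymbol (hψ : IsCutoff ψ) (k : ℤ) :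
    HasCompactSupport (fun ξ => (dyadicSymbol ψ k ξ : ℂ)) := by
  refine HasCompactSupport.of_support_subset_isCompact
    (isCompact_closedBall (0 : 𝔼) (2 * 2 ^ k)) fun ξ hξ => ?_
  by_contra h
  refine hξ ?_
  simp only [Metric.mem_closedBall, dist_zero_right, not_le] at h
  simp [dyadicSymbol_eq_zero_of_lt hψ h]

theorem hasTemperateGrowth_dyadicSymbol (hψ : IsCutoff ψ) (k : ℤ) :
    Function.HasTemperateGrowth (fun ξ => (dyadicSymbol ψ k ξ : ℂ)) :=
  (hasCompactSupport_dyadicSymbol hψ k).hasTemperateGrowth (contDiff_dyadicSymbol hψ k)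

/-- The dyadic symbol as a Schwartz function. -/
def dyadicSchwartz (hψ : IsCutoff ψ) (k : ℤ) : 𝓢(𝔼, ℂ) :=
  (hasCompactSupport_dyadicSymbol hψ k).toSchwartzMap (contDiff_dyadicSymbol hψ k)

@[simp]
theorem dyadicSchwartz_apply (hψ : IsCutoff ψ) (k : ℤ) (ξ : 𝔼) :
    dyadicSchwartz hψ k ξ = dyadicSymbol ψ k ξ := rfl

theorem IsRepresentedBy.ae_eq {T : 𝓢'(𝔼, ℂ)} {g h : 𝔼 → ℂ} (hg : IsRepresentedBy T g)
    (hh : IsRepresentedBy T h) : g =ᵐ[volume] h :=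
  ae_eq_of_integral_schwartz_mul_eq hg.1 hh.1 fun w => by rw [← (hg.2 w).2, (hh.2 w).2]

theorem IsRepresentedBy.lpNorm_eq {T : 𝓢'(𝔼, ℂ)} {g : 𝔼 → ℂ} (hg : IsRepresentedBy T g)
    (p : ℝ≥0∞) : lpNorm p T = eLpNorm g p volume := by
  refine le_antisymm (iInf₂_le g hg) (le_iInf₂ fun h hh => ?_)
  rw [eLpNorm_congr_ae (hg.ae_eq hh)]

theorem exists_isRepresentedBy_of_lpNorm_ne_top {T : 𝓢'(𝔼, ℂ)} {p : ℝ≥0∞} (h : lpNorm p T ≠ ∞) :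
    ∃ g, IsRepresentedBy T g := by
  by_contra! h'
  exact h (by simp [lpNorm, h'])

/-- Bump function of radius `ε`, of integral one. -/
def mollifier (n : ℕ) (ε : ℝ) (hε : 0 < ε) : 𝓢(EuclideanSpace ℝ (Fin n), ℂ) :=
  letI b : ContDiffBump (0 : EuclideanSpace ℝ (Fin n)) :=
    ⟨ε / 2, ε, by positivity, by linarith⟩
  HasCompactSupport.toSchwartzMap (f := fun x => ((b.normed volume x : ℝ) : ℂ))
    (b.hasCompactSupport_normed.comp_left (g := fun t : ℝ => (t : ℂ)) (by simp))
    (Complex.ofRealCLM.contDiff.comp b.contDiff_normed)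

theorem mollifier_eq_zero {ε : ℝ} (hε : 0 < ε) {x : 𝔼} (hx : ε ≤ ‖x‖) :
    mollifier n ε hε x = 0 := by
  set b : ContDiffBump (0 : EuclideanSpace ℝ (Fin n)) :=
    ⟨ε / 2, ε, by positivity, by linarith⟩ with hb
  have h : b.normed volume x = 0 := by
    rw [ContDiffBump.normed_def, b.zero_of_le_dist (by simpa [hb] using hx), zero_div]
  change ((b.normed volume x : ℝ) : ℂ) = 0
  simp [h]

theorem integral_norm_mollifier {ε : ℝ} (hε : 0 < ε) : ∫ x : 𝔼, ‖mollifier n ε hε x‖ = 1 := by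
  set b : ContDiffBump (0 : EuclideanSpace ℝ (Fin n)) :=
    ⟨ε / 2, ε, by positivity, by linarith⟩ with hb
  have h : ∀ x, ‖mollifier n ε hε x‖ = b.normed volume x := fun x => by
    change ‖((b.normed volume x : ℝ) : ℂ)‖ = _
    rw [Complex.norm_real, Real.norm_of_nonneg (b.nonneg_normed x)]
  simp_rw [h]
  exact b.integral_normed

theorem integral_mollifier {ε : ℝ} (hε : 0 < ε) : ∫ x : 𝔼, mollifier n ε hε x = 1 := by
  set b : ContDiffBump (0 : EuclideanSpace ℝ (Fin n)) :=
    ⟨ε / 2, ε, by positivity, by linarith⟩ with hb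
  change ∫ x : 𝔼, ((b.normed volume x : ℝ) : ℂ) = 1
  rw [integral_complex_ofReal, b.integral_normed]; simp

/-- The regularising factor 𝓕(mollifier) does not increase L^r norms; since it tends to 1 pointwise
as ε → 0, by the next estimate, it can be removed at the end. -/
theorem norm_fourier_mollifier_le {ε : ℝ} (hε : 0 < ε) (x : 𝔼) :
    ‖𝓕 (mollifier n ε hε) x‖ ≤ 1 := by
  rw [← integral_norm_mollifier hε, SchwartzMap.fourier_coe]
  exact norm_fourier_le_integral _ _

theorem norm_fourier_mollifier_sub_one_le {ε : ℝ} (hε : 0 < ε) (x : 𝔼) :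
    ‖𝓕 (mollifier n ε hε) x - 1‖ ≤ 2 * Real.pi * ‖x‖ * ε := by
  have hi := (mollifier n ε hε).integrable (μ := volume)
  have hi' : Integrable (fun y => 𝐞 (-⟪y, x⟫) • mollifier n ε hε y) :=
    (Real.fourierIntegral_convergent_iff x).2 hi
  rw [SchwartzMap.fourier_coe, Real.fourier_eq, ← integral_mollifier (n := n) hε,
    ← integral_sub hi' hi]
  calc _ ≤ ∫ y, 2 * Real.pi * ‖x‖ * ε * ‖mollifier n ε hε y‖ := by
        refine norm_integral_le_of_norm_le (hi.norm.const_mul _) (Filter.Eventually.of_forall ?_)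
        intro y
        rcases le_or_gt ε ‖y‖ with h | h
        · simp [mollifier_eq_zero hε h]
        · have : 𝐞 (-⟪y, x⟫) • mollifier n ε hε y - mollifier n ε hε y =
              ((𝐞 (-⟪y, x⟫) : ℂ) - 1) * mollifier n ε hε y := by
            rw [Circle.smul_def, smul_eq_mul]; ring
          rw [this, norm_mul]
          gcongr
          rw [Real.fourierChar_apply]
          have h := Real.norm_exp_I_mul_ofReal_sub_one_le (x := 2 * Real.pi * -⟪y, x⟫)
          rw [mul_comm Complex.I] at h
          refine h.trans ?_
          rw [norm_mul, norm_neg, Real.norm_of_nonneg (by positivity)]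
          have := norm_inner_le_norm (𝕜 := ℝ) y x
          have h3 : ‖y‖ * ‖x‖ ≤ ‖x‖ * ε := by rw [mul_comm]; gcongr
          rw [mul_assoc _ ‖x‖]
          gcongr
          exact this.trans h3
    _ = _ := by rw [integral_const_mul, integral_norm_mollifier, mul_one]

/-- The Fourier transform of `Δ_k u` times a function with spectrum in the ball of radius `ε` is
supported in the ball of radius `2 ^ (k + 1) + ε`. -/
theorem fourier_mul_fourier_mollifier_eq_zero (hψ : IsCutoff ψ) {k : ℤ} {u : 𝓢'(𝔼, ℂ)} {g : 𝔼 → ℂ}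
    (hg : IsRepresentedBy (dyadicBlock ψ k u) g) {ε : ℝ} (hε : 0 < ε) {ζ : 𝔼}
    (hζ : 2 * 2 ^ k + ε < ‖ζ‖) :
    𝓕 (fun x => 𝓕 (mollifier n ε hε) x * g x) ζ = 0 := by
  -- The transform at ζ is the pairing of Δ_k u with 𝓕 W, where W is the mollifier moved to ζ. It
  -- vanishes because φ_k and W have disjoint supports.
  set W : 𝓢(𝔼, ℂ) := SchwartzMap.compSubConstCLM ℂ ζ (mollifier n ε hε) with hW
  have hWF : ∀ x, 𝓕 W x = 𝐞 (-⟪x, ζ⟫) • 𝓕 (mollifier n ε hε) x := fun x => by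
    rw [SchwartzMap.fourier_coe, SchwartzMap.fourier_coe, Real.fourier_eq, Real.fourier_eq,
      ← integral_add_right_eq_self _ ζ, Circle.smul_def, ← integral_smul]
    congr 1 with y
    simp only [hW, SchwartzMap.compSubConstCLM_apply, add_sub_cancel_right]
    rw [inner_add_left, neg_add, AddChar.map_add_eq_mul, mul_comm, mul_smul, Circle.smul_def,
      real_inner_comm ζ x]
  have h0 : SchwartzMap.smulLeftCLM ℂ (fun ξ => (dyadicSymbol ψ k ξ : ℂ)) W = 0 := by
    ext ξ
    rw [SchwartzMap.smulLeftCLM_apply_apply (hasTemperateGrowth_dyadicSymbol hψ k)]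
    rcases lt_or_ge (2 * 2 ^ k) ‖ξ‖ with h | h
    · simp [dyadicSymbol_eq_zero_of_lt hψ h]
    · have : ε ≤ ‖ξ - ζ‖ := by
        have := norm_sub_norm_le ζ ξ
        rw [norm_sub_rev] at this
        linarith
      simp [hW, mollifier_eq_zero hε this]
  have h1 : dyadicBlock ψ k u (𝓕 W) = 0 := by
    rw [dyadicBlock, TemperedDistribution.fourierMultiplierCLM_apply_apply,
      FourierTransform.fourierInv_fourier_eq, h0]
    simp
  rw [(hg.2 _).2] at h1
  rw [Real.fourier_eq, ← h1]
  congr 1 with x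
  rw [hWF, smul_mul_assoc]

end Symbol

/-! ### Nikolskii's inequality for dyadic blocks, uniformly in k. -/

section Nikolskii

variable {n : ℕ} {ψ : EuclideanSpace ℝ (Fin n) → ℝ}

local notation "𝔼" => EuclideanSpace ℝ (Fin n)

theorem fourierInv_comp_two_zpow_smul (m : 𝔼 → ℂ) (k : ℤ) (x : 𝔼) :
    𝓕⁻ (fun ξ => m ((2 : ℝ) ^ (-k) • ξ)) x = (((2 : ℝ) ^ k) ^ n) • 𝓕⁻ m ((2 : ℝ) ^ k • x) := by
  have := fourierInv_comp_smul_sub m (c := (2 : ℝ) ^ (-k)) (by positivity) 0 x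
  simp only [sub_zero, inner_zero_left, AddChar.map_zero_eq_one, one_smul,
    finrank_euclideanSpace_fin] at this
  rw [this, abs_of_nonneg (by positivity), ← inv_pow, ← zpow_neg, neg_neg]

/-- Pointwise and `L¹` bounds of the dyadic dilations of a Schwartz kernel. -/
theorem exists_dilated_kernel_bounds (m : 𝓢(𝔼, ℂ)) :
    ∃ A B : ℝ≥0, ∀ k : ℤ,
      (∀ x, ‖𝓕⁻ (fun ξ => m ((2 : ℝ) ^ (-k) • ξ)) x‖ₑ ≤ ((A * (2 ^ k) ^ n : ℝ≥0) : ℝ≥0∞)) ∧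
      ∫⁻ x, ‖𝓕⁻ (fun ξ => m ((2 : ℝ) ^ (-k) • ξ)) x‖ₑ ≤ B := by
  have hint := (𝓕⁻ m).integrable (μ := volume)
  obtain ⟨A, hA⟩ : ∃ A : ℝ≥0, ∀ x, ‖𝓕⁻ m x‖₊ ≤ A :=
    ⟨Real.toNNReal (SchwartzMap.seminorm ℝ 0 0 (𝓕⁻ m)), fun x =>
      NNReal.le_toNNReal_of_coe_le (SchwartzMap.norm_le_seminorm ℝ (𝓕⁻ m) x)⟩
  refine ⟨A, NNReal.mk (∫ x, ‖𝓕⁻ m x‖) (by positivity), fun k => ⟨fun x => ?_, ?_⟩⟩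
  · rw [fourierInv_comp_two_zpow_smul, ← SchwartzMap.fourierInv_coe, enorm_smul, mul_comm]
    rw [ENNReal.coe_mul]
    gcongr
    · rw [enorm_eq_nnnorm]
      exact ENNReal.coe_le_coe.2 (hA _)
    · rw [enorm_eq_nnnorm]
      refine ENNReal.coe_le_coe.2 (le_of_eq ?_)
      ext
      simp
  · have h1 : ∀ x, 𝓕⁻ (fun ξ => m ((2 : ℝ) ^ (-k) • ξ)) x =
        (((2 : ℝ) ^ k) ^ n) • (𝓕⁻ m) ((2 : ℝ) ^ k • x) := fun x => by
      rw [fourierInv_comp_two_zpow_smul, ← SchwartzMap.fourierInv_coe]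
    simp_rw [h1]
    have h2 : Integrable fun x => (((2 : ℝ) ^ k) ^ n) • (𝓕⁻ m) ((2 : ℝ) ^ k • x) :=
      (hint.comp_smul (zpow_ne_zero k two_ne_zero)).smul (((2 : ℝ) ^ k) ^ n)
    rw [← ofReal_integral_norm_eq_lintegral_enorm h2]
    simp_rw [norm_smul]
    rw [integral_const_mul, Measure.integral_comp_smul volume (fun x => ‖𝓕⁻ m x‖)]
    rw [finrank_euclideanSpace_fin, abs_of_nonneg (by positivity),
      Real.norm_of_nonneg (by positivity), smul_eq_mul, mul_inv_cancel_left₀ (by positivity),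
      ENNReal.ofReal_eq_coe_nnreal (by positivity)]

/-- A smooth function equal to one on the ball of radius three. -/
def plateau (n : ℕ) : 𝓢(EuclideanSpace ℝ (Fin n), ℂ) :=
  letI b : ContDiffBump (0 : EuclideanSpace ℝ (Fin n)) := ⟨3, 4, by norm_num, by norm_num⟩
  HasCompactSupport.toSchwartzMap (f := fun x => ((b x : ℝ) : ℂ))
    (b.hasCompactSupport.comp_left (g := fun t : ℝ => (t : ℂ)) (by simp))
    (Complex.ofRealCLM.contDiff.comp b.contDiff)

theorem plateau_eq_one {ξ : 𝔼} (h : ‖ξ‖ ≤ 3) : plateau n ξ = 1 := by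
  set b : ContDiffBump (0 : EuclideanSpace ℝ (Fin n)) := ⟨3, 4, by norm_num, by norm_num⟩ with hb
  have : b ξ = 1 := b.one_of_mem_closedBall (by simpa [hb] using h)
  change ((b ξ : ℝ) : ℂ) = 1
  simp [this]

/-- Nikolskii's inequality for the dyadic blocks of a tempered distribution. -/
theorem exists_eLpNorm_top_dyadicBlock_le (hψ : IsCutoff ψ) :
    ∃ A B : ℝ≥0, ∀ (k : ℤ) (u : 𝓢'(𝔼, ℂ)) (g : 𝔼 → ℂ), IsRepresentedBy (dyadicBlock ψ k u) g →
      ∀ r : ℝ≥0∞, 0 < r → eLpNorm g ∞ volume ≤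
        ((A * (2 ^ k) ^ n : ℝ≥0) : ℝ≥0∞) ^ (r⁻¹).toReal * ((1 + B : ℝ≥0) : ℝ≥0∞) *
          eLpNorm g r volume := by
  obtain ⟨A, B, hAB⟩ := exists_dilated_kernel_bounds (plateau n)
  refine ⟨A, B, fun k u g hg r hr => ?_⟩
  set D : ℝ≥0∞ := ((A * (2 ^ k) ^ n : ℝ≥0) : ℝ≥0∞) ^ (r⁻¹).toReal * ((1 + B : ℝ≥0) : ℝ≥0∞)
  set m : 𝔼 → ℂ := fun ξ => plateau n ((2 : ℝ) ^ (-k) • ξ) with hm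
  have h2k : (0 : ℝ) < 2 ^ k := by positivity
  have hmint : Integrable m := ((plateau n).integrable (μ := volume)).comp_smul (by positivity)
  have hKcont : Continuous (𝓕⁻ m) := by
    have h : 𝓕⁻ m = fun x => (((2 : ℝ) ^ k) ^ n) • (𝓕⁻ (plateau n)) ((2 : ℝ) ^ k • x) := by
      ext x
      rw [hm, fourierInv_comp_two_zpow_smul, ← SchwartzMap.fourierInv_coe]
    rw [h]
    have := (𝓕⁻ (plateau n)).continuous
    fun_prop
  have hgm : AEStronglyMeasurable g volume := hg.1.aestronglyMeasurable
  -- The function g need not be integrable, but its product with a Schwartz factor is. For ε ≤ 2^k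
  -- the spectrum stays within radius 3 · 2^k, where m = 1, and the bound does not depend on ε.
  have step : ∀ ε (hε : 0 < ε), ε ≤ 2 ^ k →
      ∀ᵐ x, ‖𝓕 (mollifier n ε hε) x * g x‖ₑ ≤ D * eLpNorm g r volume := by
    intro ε hε hεk
    set f : 𝔼 → ℂ := fun x => 𝓕 (mollifier n ε hε) x * g x with hf
    have hfint : Integrable f := (hg.2 _).1
    have hsupp : ∀ ξ, 𝓕 f ξ ≠ 0 → ‖ξ‖ ≤ 3 * 2 ^ k := fun ξ hξ => by
      by_contra! h
      exact hξ (fourier_mul_fourier_mollifier_eq_zero hψ hg hε (by linarith))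
    have hc : HasCompactSupport (𝓕 f) :=
      HasCompactSupport.of_support_subset_isCompact (isCompact_closedBall (0 : 𝔼) (3 * 2 ^ k))
        fun ξ hξ => by simpa using hsupp ξ hξ
    have hone : ∀ ξ, 𝓕 f ξ ≠ 0 → m ξ = 1 := fun ξ hξ => by
      refine plateau_eq_one ?_
      rw [norm_smul, Real.norm_of_nonneg (by positivity), zpow_neg, inv_mul_eq_div,
        div_le_iff₀ h2k]
      exact hsupp ξ hξ
    have hrep : ∀ᵐ x, ‖f x‖ₑ ≤ ∫⁻ y, ‖f y‖ₑ * ‖𝓕⁻ m (x - y)‖ₑ := by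
      filter_upwards [ae_eq_integral_mul_kernel hfint hmint hc hone] with x hx
      rw [hx]
      refine (enorm_integral_le_lintegral_enorm _).trans_eq ?_
      simp_rw [enorm_mul]
    have hle := eLpNorm_top_le_of_kernel hfint.1
      (by rw [eLpNorm_one_eq_lintegral_enorm]; exact hfint.2.ne) hKcont.measurable hrep
      (hAB k).1 (hAB k).2 hr
    have hfg : eLpNorm f r volume ≤ eLpNorm g r volume := by
      refine eLpNorm_mono fun x => ?_
      rw [hf, norm_mul]
      exact mul_le_of_le_one_left (norm_nonneg _) (norm_fourier_mollifier_le hε x)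
    rw [eLpNorm_exponent_top] at hle
    filter_upwards [enorm_ae_le_eLpNormEssSup f volume] with x hx
    exact hx.trans (hle.trans (by gcongr))
  -- A sequence of radii tending to 0 keeps the exceptional set null, so the limit can be taken
  -- pointwise.
  have hpos : ∀ j : ℕ, 0 < (2 : ℝ) ^ k / (j + 1) := fun j => by positivity
  have hall : ∀ᵐ x, ∀ j : ℕ,
      ‖𝓕 (mollifier n _ (hpos j)) x * g x‖ₑ ≤ D * eLpNorm g r volume :=
    ae_all_iff.2 fun j => step _ _ (div_le_self h2k.le (by linarith [j.cast_nonneg (α := ℝ)]))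
  rw [eLpNorm_exponent_top]
  refine essSup_le_of_ae_le _ ?_
  filter_upwards [hall] with x hx
  have hε0 : Filter.Tendsto (fun j : ℕ => (2 : ℝ) ^ k / (j + 1)) Filter.atTop (𝓝 0) := by
    simpa [div_eq_mul_inv] using
      (tendsto_one_div_add_atTop_nhds_zero_nat (𝕜 := ℝ)).const_mul ((2 : ℝ) ^ k)
  have h1 : Filter.Tendsto (fun j : ℕ => 𝓕 (mollifier n _ (hpos j)) x) Filter.atTop (𝓝 1) := by
    rw [tendsto_iff_norm_sub_tendsto_zero]
    refine squeeze_zero (fun _ => norm_nonneg _)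
      (fun j => norm_fourier_mollifier_sub_one_le (hpos j) x) ?_
    simpa using hε0.const_mul (2 * Real.pi * ‖x‖)
  have h2 := (h1.mul_const (g x)).enorm
  rw [one_mul] at h2
  exact le_of_tendsto h2 (Filter.Eventually.of_forall hx)

end Nikolskii

/-! ### Hölder interpolation combined with Nikolskii's inequality. -/

section Interpolation

theorem eq_of_toReal_inv_eq {p r : ℝ≥0∞} (hp : 0 < p) (hr : 0 < r)
    (h : (p⁻¹).toReal = (r⁻¹).toReal) : p = r := by
  have := (ENNReal.toReal_eq_toReal_iff' (by simpa using hp.ne') (by simpa using hr.ne')).1 h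
  simpa using this

/-- Hölder's interpolation inequality in the whole range `0 < p ≤ ∞`. -/
theorem eLpNorm_le_rpow_mul_rpow {α : Type*} [MeasurableSpace α] {μ : Measure α} {g : α → ℂ}
    (hg : AEStronglyMeasurable g μ) {p₀ p₁ r : ℝ≥0∞} (hp₀ : 0 < p₀) (hp₁ : 0 < p₁) (hr : 0 < r)
    {τ : ℝ} (h0 : 0 ≤ τ) (h1 : τ ≤ 1)
    (h : (r⁻¹).toReal = (1 - τ) * (p₀⁻¹).toReal + τ * (p₁⁻¹).toReal) :
    eLpNorm g r μ ≤ eLpNorm g p₀ μ ^ (1 - τ) * eLpNorm g p₁ μ ^ τ := by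
  rcases h0.eq_or_lt with rfl | h0
  · have := eq_of_toReal_inv_eq hr hp₀ (by simpa using h)
    simp [this]
  rcases h1.eq_or_lt with rfl | h1
  · have := eq_of_toReal_inv_eq hr hp₁ (by simpa using h)
    simp [this]
  have h1' : 0 < 1 - τ := by linarith
  have t0 : ENNReal.ofReal τ ≠ 0 := by simpa using h0
  have t1 : ENNReal.ofReal (1 - τ) ≠ 0 := by simpa using h1
  have e0 : p₀ / ENNReal.ofReal (1 - τ) * ENNReal.ofReal (1 - τ) = p₀ :=
    ENNReal.div_mul_cancel t1 (by simp)
  have e1 : p₁ / ENNReal.ofReal τ * ENNReal.ofReal τ = p₁ := ENNReal.div_mul_cancel t0 (by simp)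
  have f0 : p₀⁻¹ ≠ ∞ := by simpa using hp₀.ne'
  have f1 : p₁⁻¹ ≠ ∞ := by simpa using hp₁.ne'
  have : ENNReal.HolderTriple (p₀ / ENNReal.ofReal (1 - τ)) (p₁ / ENNReal.ofReal τ) r := by
    refine ⟨?_⟩
    rw [ENNReal.inv_div (Or.inl (by simp)) (Or.inl t1),
      ENNReal.inv_div (Or.inl (by simp)) (Or.inl t0)]
    simp only [div_eq_mul_inv]
    rw [← ENNReal.toReal_eq_toReal_iff' (by finiteness) (by simpa using hr.ne'), h,
      ENNReal.toReal_add (by finiteness) (by finiteness), ENNReal.toReal_mul, ENNReal.toReal_mul,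
      ENNReal.toReal_ofReal h0.le, ENNReal.toReal_ofReal h1'.le]
  have m0 : AEStronglyMeasurable (fun x => ‖g x‖ ^ (1 - τ)) μ :=
    (hg.norm.aemeasurable.pow_const _).aestronglyMeasurable
  have m1 : AEStronglyMeasurable (fun x => ‖g x‖ ^ τ) μ :=
    (hg.norm.aemeasurable.pow_const _).aestronglyMeasurable
  have key := eLpNorm_smul_le_mul_eLpNorm (p := p₀ / ENNReal.ofReal (1 - τ))
    (q := p₁ / ENNReal.ofReal τ) (r := r) m1 m0
  rw [eLpNorm_norm_rpow g h0, eLpNorm_norm_rpow g h1', e0, e1] at key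
  refine le_trans (eLpNorm_mono fun x => ?_) key
  simp only [Pi.smul_apply', smul_eq_mul]
  rw [← Real.rpow_add_of_nonneg (norm_nonneg _) h1'.le h0.le, sub_add_cancel, Real.rpow_one,
    norm_norm]

/-- Pass through L^r with 1/r = a: Hölder between p₀ and p₁ controls L^r, Hölder between r and ∞
controls L^p, and the L^∞ factor goes back to L^r by `hQ`. -/
theorem eLpNorm_le_of_nikolskii {α : Type*} [MeasurableSpace α] {μ : Measure α} {g : α → ℂ}
    (hg : AEStronglyMeasurable g μ) {p₀ p₁ p : ℝ≥0∞} (hp₀ : 0 < p₀) (hp₁ : 0 < p₁) (hp : 0 < p)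
    {τ : ℝ} (h0 : 0 ≤ τ) (h1 : τ ≤ 1) {a : ℝ}
    (ha : a = (1 - τ) * (p₀⁻¹).toReal + τ * (p₁⁻¹).toReal) (hpa : (p⁻¹).toReal ≤ a)
    {Q : ℝ≥0∞} {B : ℝ≥0}
    (hQ : ∀ r : ℝ≥0∞, 0 < r →
      eLpNorm g ∞ μ ≤ Q ^ (r⁻¹).toReal * ((1 + B : ℝ≥0) : ℝ≥0∞) * eLpNorm g r μ) :
    eLpNorm g p μ ≤ Q ^ (a - (p⁻¹).toReal) * ((1 + B : ℝ≥0) : ℝ≥0∞) *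
      (eLpNorm g p₀ μ ^ (1 - τ) * eLpNorm g p₁ μ ^ τ) := by
  have hone : (1 : ℝ≥0∞) ≤ ((1 + B : ℝ≥0) : ℝ≥0∞) := by simp
  have ha0 : 0 ≤ a := ENNReal.toReal_nonneg.trans hpa
  set r : ℝ≥0∞ := (ENNReal.ofReal a)⁻¹ with hr
  have hr0 : 0 < r := by simp [hr]
  have hra : (r⁻¹).toReal = a := by simp [hr, ha0]
  have hI := eLpNorm_le_rpow_mul_rpow hg hp₀ hp₁ hr0 h0 h1 (hra.trans ha)
  -- The parameter solves 1/p = (1 - σ) a. If a = 0 then r = p = ∞ and σ = 0 will do.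
  obtain ⟨σ, hσ0, hσ1, hσ⟩ : ∃ σ : ℝ, 0 ≤ σ ∧ σ ≤ 1 ∧ a * σ = a - (p⁻¹).toReal := by
    rcases ha0.eq_or_lt with h | h
    · exact ⟨0, le_rfl, zero_le_one, by linarith [ENNReal.toReal_nonneg (a := p⁻¹)]⟩
    · refine ⟨1 - (p⁻¹).toReal / a, ?_, ?_, by field_simp⟩
      · have := (div_le_one h).2 hpa
        linarith
      · have : 0 ≤ (p⁻¹).toReal / a := by positivity
        linarith
  have hI2 := eLpNorm_le_rpow_mul_rpow hg hr0 (p₁ := ∞) (by simp) hp hσ0 hσ1 (by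
    rw [hra, ENNReal.inv_top, ENNReal.toReal_zero]; linarith)
  have hQr := hQ r hr0
  rw [hra] at hQr
  calc eLpNorm g p μ ≤ _ := hI2
    _ ≤ eLpNorm g r μ ^ (1 - σ) *
        (Q ^ a * ((1 + B : ℝ≥0) : ℝ≥0∞) * eLpNorm g r μ) ^ σ := by gcongr
    _ = Q ^ (a * σ) * ((1 + B : ℝ≥0) : ℝ≥0∞) ^ σ * eLpNorm g r μ := by
        rw [ENNReal.mul_rpow_of_nonneg _ _ hσ0, ENNReal.mul_rpow_of_nonneg _ _ hσ0,
          ← ENNReal.rpow_mul]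
        have : eLpNorm g r μ = eLpNorm g r μ ^ (1 - σ) * eLpNorm g r μ ^ σ := by
          rw [← ENNReal.rpow_add_of_nonneg _ _ (by linarith) hσ0]; simp
        conv_rhs => rw [this]
        ring
    _ ≤ _ := by
        rw [hσ]
        gcongr
        calc _ ≤ ((1 + B : ℝ≥0) : ℝ≥0∞) ^ (1 : ℝ) := ENNReal.rpow_le_rpow_of_exponent_le hone hσ1
          _ = _ := ENNReal.rpow_one _

end Interpolation

/-! ### Summation of two crossing geometric bounds. -/

section Geometric

theorem tsum_two_rpow_neg_abs_ne_top {c : ℝ} (hc : 0 < c) :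
    ∑' k : ℤ, (2 : ℝ≥0∞) ^ (-(c * |(k : ℝ)|)) ≠ ∞ := by
  have hs : Summable fun k : ℤ => (2 : ℝ) ^ (-(c * |(k : ℝ)|)) := by
    have hρ : Summable fun m : ℕ => (2 : ℝ) ^ (-(c * m)) := by
      have : ∀ m : ℕ, (2 : ℝ) ^ (-(c * m)) = ((2 : ℝ) ^ (-c)) ^ m := fun m => by
        rw [← Real.rpow_natCast, ← Real.rpow_mul (by norm_num)]; ring_nf
      simp_rw [this]
      exact summable_geometric_of_lt_one (by positivity)
        (Real.rpow_lt_one_of_one_lt_of_neg (by norm_num) (by linarith))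
    refine Summable.of_nat_of_neg ?_ ?_ <;> simpa using hρ
  have : ∀ k : ℤ, (2 : ℝ≥0∞) ^ (-(c * |(k : ℝ)|)) =
      ENNReal.ofReal ((2 : ℝ) ^ (-(c * |(k : ℝ)|))) := fun k => by
    rw [← ENNReal.ofReal_rpow_of_pos (by norm_num)]; simp
  simp_rw [this]
  rw [← ENNReal.ofReal_tsum_of_nonneg (fun _ => by positivity) hs]
  exact ENNReal.ofReal_ne_top

/-- Two geometric bounds with opposite slopes in `k` give an `ℓ^q` bound by the product at the
intermediate parameter. -/
theorem exists_tsum_rpow_le_of_two_bounds {θ ε D q : ℝ} (hε : 0 < ε) (h0 : 0 < θ - ε)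
    (h1 : θ + ε < 1) (hD : D ≠ 0) (hq : 0 < q) (c : ℝ≥0) :
    ∃ C : ℝ≥0, ∀ (N₀ N₁ : ℝ≥0∞), N₀ ≠ ∞ → N₁ ≠ ∞ → ∀ x : ℤ → ℝ≥0∞,
      (∀ k : ℤ, x k ≤ c * (2 ^ (k * (ε * D)) * (N₀ ^ (1 - (θ + ε)) * N₁ ^ (θ + ε)))) →
      (∀ k : ℤ, x k ≤ c * (2 ^ (k * (-ε * D)) * (N₀ ^ (1 - (θ - ε)) * N₁ ^ (θ - ε)))) →
      (∑' k, x k ^ q) ^ (1 / q) ≤ C * N₀ ^ (1 - θ) * N₁ ^ θ := by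
  have two0 : (2 : ℝ≥0∞) ≠ 0 := by simp
  have twot : (2 : ℝ≥0∞) ≠ ∞ := by simp
  set S := ∑' k : ℤ, (2 : ℝ≥0∞) ^ (-(ε * |D| * q * |(k : ℝ)|)) with hS
  have hSt : S ≠ ∞ := tsum_two_rpow_neg_abs_ne_top (by positivity)
  set C : ℝ≥0∞ := c * 2 ^ (ε * |D|) * S ^ (1 / q) with hC
  have hCt : C ≠ ∞ := by
    refine ENNReal.mul_ne_top (ENNReal.mul_ne_top (by simp) ?_)
      (ENNReal.rpow_ne_top_of_nonneg (by positivity) hSt)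
    exact ENNReal.rpow_ne_top_of_nonneg (by positivity) twot
  refine ⟨C.toNNReal, fun N₀ N₁ hN₀ hN₁ x hx1 hx2 => ?_⟩
  rw [ENNReal.coe_toNNReal hCt]
  rcases eq_or_ne N₀ 0 with rfl | hN₀'
  · have : ∀ k, x k = 0 := fun k => by
      have := hx1 k
      rw [ENNReal.zero_rpow_of_pos (by linarith)] at this
      simpa using this
    simp [this, hq]
  rcases eq_or_ne N₁ 0 with rfl | hN₁'
  · have : ∀ k, x k = 0 := fun k => by
      have := hx1 k
      rw [ENNReal.zero_rpow_of_pos (show 0 < θ + ε by linarith)] at this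
      simpa using this
    simp [this, hq]
  -- In terms of γ the two bounds are c N₀^{1-θ} N₁^θ times 2^{±ε(kD + γ)}; the better one has the
  -- exponent -ε|kD + γ|.
  obtain ⟨γ, hγ⟩ : ∃ γ : ℝ, N₁ = N₀ * 2 ^ γ := by
    have hpos : 0 < N₁.toReal / N₀.toReal :=
      div_pos (ENNReal.toReal_pos hN₁' hN₁) (ENNReal.toReal_pos hN₀' hN₀)
    refine ⟨Real.logb 2 (N₁.toReal / N₀.toReal), ?_⟩
    have : (2 : ℝ≥0∞) ^ Real.logb 2 (N₁.toReal / N₀.toReal) = N₁ / N₀ := by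
      have h2 : (2 : ℝ≥0∞) = ENNReal.ofReal 2 := by simp
      rw [h2, ENNReal.ofReal_rpow_of_pos (by norm_num),
        Real.rpow_logb (by norm_num) (by norm_num) hpos, ← ENNReal.toReal_div,
        ENNReal.ofReal_toReal (ENNReal.div_ne_top hN₁ hN₀')]
    rw [this, ENNReal.mul_div_cancel hN₀' hN₀]
  have hprod : ∀ t : ℝ, 0 ≤ t → N₀ ^ (1 - t) * N₁ ^ t = N₀ * 2 ^ (γ * t) := fun t ht => by
    rw [hγ, ENNReal.mul_rpow_of_nonneg _ _ ht, ← mul_assoc, ← ENNReal.rpow_add _ _ hN₀' hN₀,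
      ← ENNReal.rpow_mul]
    simp
  have hb : ∀ k : ℤ, x k ≤ c * (N₀ ^ (1 - θ) * N₁ ^ θ) * 2 ^ (-(ε * |k * D + γ|)) := by
    intro k
    rcases abs_cases ((k : ℝ) * D + γ) with ⟨h, -⟩ | ⟨h, -⟩
    · refine (hx2 k).trans_eq ?_
      rw [h, hprod _ h0.le, hprod _ (by linarith), mul_left_comm, mul_assoc, mul_assoc,
        mul_left_comm, mul_left_comm _ N₀]
      congr 2
      rw [← ENNReal.rpow_add _ _ two0 twot, ← ENNReal.rpow_add _ _ two0 twot]
      congr 1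
      ring
    · refine (hx1 k).trans_eq ?_
      rw [h, hprod _ (by linarith), hprod _ (by linarith), mul_left_comm, mul_assoc, mul_assoc,
        mul_left_comm, mul_left_comm _ N₀]
      congr 2
      rw [← ENNReal.rpow_add _ _ two0 twot, ← ENNReal.rpow_add _ _ two0 twot]
      congr 1
      ring
  set P := N₀ ^ (1 - θ) * N₁ ^ θ with hP
  -- The integer nearest to the crossing point. Rounding costs at most the factor 2^{ε|D|}, and
  -- translation by k₀ leaves a sum independent of N₀ and N₁.
  set k₀ : ℤ := round (-γ / D) with hk₀
  have hb' : ∀ k : ℤ, x k ^ q ≤ (c * P * 2 ^ (ε * |D|)) ^ q *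
      2 ^ (-(ε * |D| * q * |((k - k₀ : ℤ) : ℝ)|)) := by
    intro k
    have hround := abs_sub_round (-γ / D)
    have hge : |D| * (|((k - k₀ : ℤ) : ℝ)| - 1) ≤ |k * D + γ| := by
      have h3 : (k : ℝ) * D + γ = D * (k - -γ / D) := by field_simp; ring
      rw [h3, abs_mul]
      gcongr
      push_cast
      have := abs_sub_abs_le_abs_sub ((k : ℝ) - k₀) (-γ / D - k₀)
      have e : (k : ℝ) - k₀ - (-γ / D - k₀) = k - -γ / D := by ring
      rw [e] at this
      linarith
    calc x k ^ q ≤ (c * P * 2 ^ (-(ε * |k * D + γ|))) ^ q := by gcongr; exact hb k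
      _ ≤ (c * P * 2 ^ (ε * |D| + -(ε * |D| * |((k - k₀ : ℤ) : ℝ)|))) ^ q := by
          gcongr
          · simp
          · nlinarith
      _ = _ := by
          rw [ENNReal.rpow_add _ _ two0 twot, ← mul_assoc,
            ENNReal.mul_rpow_of_nonneg _ _ hq.le, ← ENNReal.rpow_mul]
          congr 2
          ring
  calc (∑' k, x k ^ q) ^ (1 / q)
      ≤ (∑' k : ℤ, (c * P * 2 ^ (ε * |D|)) ^ q *
          2 ^ (-(ε * |D| * q * |((k - k₀ : ℤ) : ℝ)|))) ^ (1 / q) := by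
        gcongr with k
        exact hb' k
    _ = ((c * P * 2 ^ (ε * |D|)) ^ q * S) ^ (1 / q) := by
        rw [ENNReal.tsum_mul_left, hS, ← (Equiv.subRight k₀).tsum_eq
          (fun k : ℤ => (2 : ℝ≥0∞) ^ (-(ε * |D| * q * |(k : ℝ)|)))]
        rfl
    _ = C * P := by
        rw [ENNReal.mul_rpow_of_nonneg _ _ (by positivity), ← ENNReal.rpow_mul,
          mul_one_div_cancel hq.ne', ENNReal.rpow_one, hC]
        ring
    _ = _ := (mul_assoc _ _ _).symm

end Geometric

/-! ### The four conditions imply the inequality. -/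

section Sufficiency

variable {n : ℕ} {ψ : EuclideanSpace ℝ (Fin n) → ℝ}

local notation "𝔼" => EuclideanSpace ℝ (Fin n)

theorem lpNorm_dyadicBlock_le (s : ℝ) (p : ℝ≥0∞) (u : 𝓢'(𝔼, ℂ)) (k : ℤ) :
    lpNorm p (dyadicBlock ψ k u) ≤ 2 ^ (-(k * s)) * besovNorm ψ s p ∞ u := by
  have h : (2 : ℝ≥0∞) ^ ((k : ℝ) * s) * lpNorm p (dyadicBlock ψ k u) ≤ besovNorm ψ s p ∞ u := by
    rw [besovNorm, if_pos rfl]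
    exact le_iSup (fun k : ℤ => (2 : ℝ≥0∞) ^ ((k : ℝ) * s) * lpNorm p (dyadicBlock ψ k u)) k
  calc _ = (2 : ℝ≥0∞) ^ (-(k * s)) * (2 ^ ((k : ℝ) * s) * lpNorm p (dyadicBlock ψ k u)) := by
        rw [← mul_assoc, ← ENNReal.rpow_add _ _ (by simp) (by simp)]; simp
    _ ≤ _ := by gcongr

/-- The parameter τ is kept free: the exponent of 2^k is the defect of the scaling identity at τ,
affine in τ, and it is needed on both sides of θ. -/
theorem exists_dyadicBlock_bound (hψ : IsCutoff ψ) {p p₀ p₁ : ℝ≥0∞} (hp : 0 < p) (hp₀ : 0 < p₀)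
    (hp₁ : 0 < p₁) (s s₀ s₁ : ℝ) {τ : ℝ} (h0 : 0 < τ) (h1 : τ < 1)
    (h : (p⁻¹).toReal ≤ (1 - τ) * (p₀⁻¹).toReal + τ * (p₁⁻¹).toReal) :
    ∃ c : ℝ≥0, ∀ (u : 𝓢'(𝔼, ℂ)) (k : ℤ), MemBesov ψ s₀ p₀ ∞ u → MemBesov ψ s₁ p₁ ∞ u →
      2 ^ ((k : ℝ) * s) * lpNorm p (dyadicBlock ψ k u) ≤
        c * (2 ^ (k * ((1 - τ) * (n * (p₀⁻¹).toReal - s₀) + τ * (n * (p₁⁻¹).toReal - s₁) -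
          (n * (p⁻¹).toReal - s))) *
          (besovNorm ψ s₀ p₀ ∞ u ^ (1 - τ) * besovNorm ψ s₁ p₁ ∞ u ^ τ)) := by
  obtain ⟨A, B, hAB⟩ := exists_eLpNorm_top_dyadicBlock_le hψ
  set e := (1 - τ) * (p₀⁻¹).toReal + τ * (p₁⁻¹).toReal - (p⁻¹).toReal with he
  have he0 : 0 ≤ e := by linarith
  refine ⟨A ^ e * (1 + B), fun u k hu0 hu1 => ?_⟩
  have hb0 := lpNorm_dyadicBlock_le (ψ := ψ) s₀ p₀ u k
  have hb1 := lpNorm_dyadicBlock_le (ψ := ψ) s₁ p₁ u k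
  have two0 : (2 : ℝ≥0∞) ≠ 0 := by simp
  have twot : (2 : ℝ≥0∞) ≠ ∞ := by simp
  obtain ⟨g, hg⟩ := exists_isRepresentedBy_of_lpNorm_ne_top
    (ne_top_of_le_ne_top (ENNReal.mul_ne_top (by simp) hu0.ne) hb0)
  rw [hg.lpNorm_eq] at hb0 hb1 ⊢
  have hQ : ((A * (2 ^ k) ^ n : ℝ≥0) : ℝ≥0∞) ^ e = (A : ℝ≥0∞) ^ e * 2 ^ (k * (n * e)) := by
    rw [ENNReal.coe_mul, ENNReal.mul_rpow_of_nonneg _ _ he0]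
    congr 1
    rw [ENNReal.coe_pow, ENNReal.coe_zpow (by simp), ENNReal.coe_ofNat, ← ENNReal.rpow_intCast,
      ← ENNReal.rpow_natCast, ← ENNReal.rpow_mul, ← ENNReal.rpow_mul]
  have key := eLpNorm_le_of_nikolskii hg.1.aestronglyMeasurable hp₀ hp₁ hp h0.le h1.le rfl h
    (hAB k u g hg)
  rw [← he, hQ] at key
  have h1' : 0 ≤ 1 - τ := by linarith
  calc 2 ^ ((k : ℝ) * s) * eLpNorm g p volume
      ≤ 2 ^ ((k : ℝ) * s) * ((A : ℝ≥0∞) ^ e * 2 ^ (k * (n * e)) * ((1 + B : ℝ≥0) : ℝ≥0∞) *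
        ((2 ^ (-(k * s₀)) * besovNorm ψ s₀ p₀ ∞ u) ^ (1 - τ) *
          (2 ^ (-(k * s₁)) * besovNorm ψ s₁ p₁ ∞ u) ^ τ)) := by
        refine mul_le_mul_right (key.trans ?_) _
        gcongr
    _ = ((A : ℝ≥0∞) ^ e * ((1 + B : ℝ≥0) : ℝ≥0∞)) *
        ((2 ^ ((k : ℝ) * s) * 2 ^ (k * (n * e)) * 2 ^ (-(k * s₀) * (1 - τ)) *
          2 ^ (-(k * s₁) * τ)) *
          (besovNorm ψ s₀ p₀ ∞ u ^ (1 - τ) * besovNorm ψ s₁ p₁ ∞ u ^ τ)) := by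
        rw [ENNReal.mul_rpow_of_nonneg _ _ h1', ENNReal.mul_rpow_of_nonneg _ _ h0.le,
          ← ENNReal.rpow_mul, ← ENNReal.rpow_mul]
        ring
    _ = _ := by
        rw [← ENNReal.rpow_add _ _ two0 twot, ← ENNReal.rpow_add _ _ two0 twot,
          ← ENNReal.rpow_add _ _ two0 twot, ENNReal.coe_mul, ENNReal.coe_rpow_of_nonneg _ he0]
        congr 4
        rw [he]
        ring

theorem exists_interpolation_bound (hψ : IsCutoff ψ) (hn : 1 ≤ n) {p p₀ p₁ q : ℝ≥0∞} (hp : 0 < p)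
    (hp₀ : 0 < p₀) (hp₁ : 0 < p₁) (hq : 0 < q) (hq' : q < ∞) {θ : ℝ} (hθ : 0 < θ) (hθ' : θ < 1)
    {s s₀ s₁ : ℝ}
    (hscale : n * (p⁻¹).toReal - s =
      (1 - θ) * (n * (p₀⁻¹).toReal - s₀) + θ * (n * (p₁⁻¹).toReal - s₁))
    (hne : s₀ - n * (p₀⁻¹).toReal ≠ s₁ - n * (p₁⁻¹).toReal)
    (hle : s ≤ (1 - θ) * s₀ + θ * s₁) (heq : s = (1 - θ) * s₀ + θ * s₁ → p₀ = p₁) :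
    ∃ C : ℝ≥0, ∀ u : 𝓢'(𝔼, ℂ), MemBesov ψ s₀ p₀ ∞ u → MemBesov ψ s₁ p₁ ∞ u →
      besovNorm ψ s p q u ≤
        C * besovNorm ψ s₀ p₀ ∞ u ^ (1 - θ) * besovNorm ψ s₁ p₁ ∞ u ^ θ := by
  set a := (p⁻¹).toReal
  set a₀ := (p₀⁻¹).toReal
  set a₁ := (p₁⁻¹).toReal
  have hn0 : (0 : ℝ) < n := by exact_mod_cast hn
  have hq0 : 0 < q.toReal := ENNReal.toReal_pos hq.ne' hq'.ne
  -- By scaling, n times the slack in 1/p ≤ (1-θ)/p₀ + θ/p₁ equals (1-θ)s₀ + θs₁ - s. Zero slack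
  -- forces p = p₀ = p₁; positive slack δ permits any small ε with ε|a₁ - a₀| ≤ δ.
  obtain ⟨ε, hε, h0, h1, hτ1, hτ2⟩ : ∃ ε : ℝ, 0 < ε ∧ 0 < θ - ε ∧ θ + ε < 1 ∧
      a ≤ (1 - (θ + ε)) * a₀ + (θ + ε) * a₁ ∧ a ≤ (1 - (θ - ε)) * a₀ + (θ - ε) * a₁ := by
    have hid : n * ((1 - θ) * a₀ + θ * a₁ - a) = (1 - θ) * s₀ + θ * s₁ - s := by linarith
    rcases hle.eq_or_lt with h | h
    · have h01 : a₀ = a₁ := by simp only [a₀, a₁, heq h]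
      have : a = a₀ := by
        have h3 : n * ((1 - θ) * a₀ + θ * a₁ - a) = 0 := by rw [hid]; linarith
        have h4 := (mul_eq_zero.1 h3).resolve_left hn0.ne'
        rw [← h01] at h4
        linarith
      have hm : 0 < min θ (1 - θ) := lt_min hθ (by linarith)
      have hm1 := min_le_left θ (1 - θ)
      have hm2 := min_le_right θ (1 - θ)
      refine ⟨min θ (1 - θ) / 2, by linarith, by linarith, by linarith, ?_, ?_⟩ <;>
      · rw [← h01, this]; linarith
    · have hpos : 0 < (1 - θ) * a₀ + θ * a₁ - a := by
        by_contra! h'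
        have := mul_nonpos_of_nonneg_of_nonpos hn0.le h'
        linarith
      set δ := (1 - θ) * a₀ + θ * a₁ - a with hδ
      have hm : 0 < min θ (1 - θ) := lt_min hθ (by linarith)
      have hm1 := min_le_left θ (1 - θ)
      have hm2 := min_le_right θ (1 - θ)
      have hd : 0 < δ / (|a₁ - a₀| + 1) := by positivity
      set ε := min (min θ (1 - θ) / 2) (δ / (|a₁ - a₀| + 1)) with hεdef
      have e1 : ε ≤ min θ (1 - θ) / 2 := min_le_left _ _
      have e2 : ε ≤ δ / (|a₁ - a₀| + 1) := min_le_right _ _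
      have e0 : 0 < ε := lt_min (by linarith) hd
      have e3 : ε * |a₁ - a₀| ≤ δ := by
        rw [le_div_iff₀ (by positivity)] at e2
        linarith
      have e4 : |ε * (a₁ - a₀)| ≤ δ := by rwa [abs_mul, abs_of_pos e0]
      have e5 := abs_le.1 e4
      exact ⟨ε, e0, by linarith, by linarith, by linarith, by linarith⟩
  obtain ⟨c₁, hc₁⟩ := exists_dyadicBlock_bound (ψ := ψ) hψ hp hp₀ hp₁ s s₀ s₁
    (show 0 < θ + ε by linarith) h1 hτ1
  obtain ⟨c₂, hc₂⟩ := exists_dyadicBlock_bound (ψ := ψ) hψ hp hp₀ hp₁ s s₀ s₁ h0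
    (show θ - ε < 1 by linarith) hτ2
  set D := (n * a₁ - s₁) - (n * a₀ - s₀) with hD
  have hD0 : D ≠ 0 := fun h => hne (by linarith)
  obtain ⟨C, hC⟩ := exists_tsum_rpow_le_of_two_bounds hε h0 h1 hD0 hq0 (max c₁ c₂)
  refine ⟨C, fun u hu0 hu1 => ?_⟩
  rw [besovNorm, if_neg hq'.ne]
  refine hC _ _ hu0.ne hu1.ne _ (fun k => ?_) fun k => ?_
  · refine (hc₁ u k hu0 hu1).trans ?_
    have : (1 - (θ + ε)) * (n * a₀ - s₀) + (θ + ε) * (n * a₁ - s₁) - (n * a - s) = ε * D := by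
      rw [hscale, hD]; ring
    rw [this]
    gcongr
    exact le_max_left _ _
  · refine (hc₂ u k hu0 hu1).trans ?_
    have : (1 - (θ - ε)) * (n * a₀ - s₀) + (θ - ε) * (n * a₁ - s₁) - (n * a - s) = -ε * D := by
      rw [hscale, hD]; ring
    rw [this]
    gcongr
    exact le_max_right _ _

end Sufficiency

/-! ### Wave packets and the size of their dyadic blocks. -/

section Packet

variable {n : ℕ} {ψ : EuclideanSpace ℝ (Fin n) → ℝ}

local notation "𝔼" => EuclideanSpace ℝ (Fin n)

theorem eLpNorm_comp_inv_smul {f : 𝔼 → ℂ} (hf : AEStronglyMeasurable f volume) {t : ℝ} (ht : 0 < t)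
    (r : ℝ≥0∞) :
    eLpNorm (fun x => f (t⁻¹ • x)) r volume =
      ENNReal.ofReal t ^ (n * (r⁻¹).toReal) * eLpNorm f r volume := by
  have ht' : t⁻¹ ≠ 0 := inv_ne_zero ht.ne'
  have hmap := Measure.map_addHaar_smul (volume : Measure 𝔼) ht'
  rw [finrank_euclideanSpace_fin, abs_of_nonneg (by positivity), inv_pow, inv_inv,
    ENNReal.ofReal_pow ht.le] at hmap
  have h := eLpNorm_map_measure (μ := (volume : Measure 𝔼)) (f := fun x : 𝔼 => t⁻¹ • x) (g := f)
    (p := r) (by rw [hmap]; exact hf.smul_measure _) (by fun_prop)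
  rw [hmap, eLpNorm_smul_measure_of_ne_zero (by simp [ht])] at h
  change eLpNorm (f ∘ fun x => t⁻¹ • x) r volume = _
  rw [← h, smul_eq_mul, ENNReal.rpow_mul, ENNReal.rpow_natCast, one_div]

theorem packetSymbol_aux (v : 𝔼) {t : ℝ} (ht : 0 < t) {ξ : 𝔼} (h : 1 / 2 ≤ t * ‖ξ - v‖) :
    ((t ^ n : ℝ) : ℂ) * mollifier n (1 / 2) (by norm_num) (t • (ξ - v)) = 0 := by
  rw [mollifier_eq_zero _ (by rwa [norm_smul, Real.norm_of_nonneg ht.le]), mul_zero]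

/-- The Fourier transform of a wave packet: a bump of radius `1 / (2 t)` around the frequency `v`,
of integral one. -/
def packetSymbol (v : 𝔼) (t : ℝ) (ht : 0 < t) : 𝓢(𝔼, ℂ) :=
  HasCompactSupport.toSchwartzMap
    (f := fun ξ => ((t ^ n : ℝ) : ℂ) * mollifier n (1 / 2) (by norm_num) (t • (ξ - v)))
    (HasCompactSupport.of_support_subset_isCompact (isCompact_closedBall v (1 / 2 / t))
      fun ξ hξ => by
        by_contra h
        refine hξ (packetSymbol_aux v ht ?_)
        rw [Metric.mem_closedBall, dist_eq_norm, not_le, div_lt_iff₀ ht] at h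
        linarith)
    (contDiff_const.mul (((mollifier n (1 / 2) (by norm_num)).smooth ⊤).comp
      ((contDiff_id.sub contDiff_const).const_smul t)))

theorem packetSymbol_eq_zero (v : 𝔼) {t : ℝ} (ht : 0 < t) {ξ : 𝔼} (h : 1 / 2 ≤ t * ‖ξ - v‖) :
    packetSymbol v t ht ξ = 0 :=
  packetSymbol_aux v ht h

/-- The wave packet of frequency `v` and width `t`. -/
def packet (v : 𝔼) (t : ℝ) (ht : 0 < t) : 𝓢(𝔼, ℂ) := 𝓕⁻ (packetSymbol v t ht)

variable (n) in
/-- The envelope of the wave packets. -/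
def envelope : 𝓢(𝔼, ℂ) := 𝓕⁻ (mollifier n (1 / 2) (by norm_num))

/-- The frequency enters only through a phase, and the factor t^n in the symbol cancels the
Jacobian. -/
theorem norm_packet_apply (v : 𝔼) {t : ℝ} (ht : 0 < t) (x : 𝔼) :
    ‖packet v t ht x‖ = ‖envelope n (t⁻¹ • x)‖ := by
  have h : packet v t ht x = _ := (SchwartzMap.fourierInv_coe (packetSymbol v t ht) ▸ rfl :
    packet v t ht x = 𝓕⁻ (packetSymbol v t ht : 𝔼 → ℂ) x).trans (fourierInv_comp_smul_sub
      (fun η => ((t ^ n : ℝ) : ℂ) * mollifier n (1 / 2) (by norm_num) η) ht.ne' v x)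
  rw [h, Circle.norm_smul, norm_smul, envelope,
    SchwartzMap.fourierInv_coe, finrank_euclideanSpace_fin, Real.fourierInv_eq, Real.fourierInv_eq]
  have h2 : ∀ η : 𝔼, 𝐞 ⟪η, t⁻¹ • x⟫ • (((t ^ n : ℝ) : ℂ) * mollifier n (1 / 2) (by norm_num) η) =
      ((t ^ n : ℝ) : ℂ) * (𝐞 ⟪η, t⁻¹ • x⟫ • mollifier n (1 / 2) (by norm_num) η) := fun η => by
    rw [Circle.smul_def, Circle.smul_def, smul_eq_mul, smul_eq_mul]; ring
  simp_rw [h2]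
  rw [integral_const_mul, norm_mul, Complex.norm_real, ← mul_assoc, abs_of_nonneg (by positivity),
    Real.norm_of_nonneg (by positivity), Real.norm_of_nonneg (by positivity),
    inv_mul_cancel₀ (by positivity), one_mul]

theorem eLpNorm_packet (v : 𝔼) {t : ℝ} (ht : 0 < t) (r : ℝ≥0∞) :
    eLpNorm (packet v t ht) r volume =
      ENNReal.ofReal t ^ (n * (r⁻¹).toReal) * eLpNorm (envelope n) r volume := by
  rw [← eLpNorm_comp_inv_smul (envelope n).continuous.aestronglyMeasurable ht]
  exact eLpNorm_congr_norm_ae (Filter.Eventually.of_forall fun x => norm_packet_apply v ht x)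

/-- The envelope is continuous, and its value at the origin is the integral of the mollifier, which
is 1. -/
theorem eLpNorm_envelope_ne_zero {r : ℝ≥0∞} (hr : 0 < r) :
    eLpNorm (envelope n) r volume ≠ 0 := by
  intro h
  rw [eLpNorm_eq_zero_iff (envelope n).continuous.aestronglyMeasurable hr.ne'] at h
  have h2 := Continuous.ae_eq_iff_eq volume (envelope n).continuous continuous_zero |>.1 h
  have h3 := congrFun h2 0
  rw [envelope, SchwartzMap.fourierInv_coe, Real.fourierInv_eq] at h3
  simp only [inner_zero_right, AddChar.map_zero_eq_one, one_smul, Pi.zero_apply,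
    integral_mollifier] at h3
  exact one_ne_zero h3

variable (ψ) in
/-- The dyadic operator on Schwartz functions. -/
def schwartzBlock (k : ℤ) : 𝓢(𝔼, ℂ) →L[ℂ] 𝓢(𝔼, ℂ) :=
  SchwartzMap.fourierMultiplierCLM ℂ (fun ξ => (dyadicSymbol ψ k ξ : ℂ))

theorem isRepresentedBy_schwartzBlock (hψ : IsCutoff ψ) (k : ℤ) (u : 𝓢(𝔼, ℂ)) :
    IsRepresentedBy (dyadicBlock ψ k (u : 𝓢'(𝔼, ℂ))) (schwartzBlock ψ k u) := by
  refine ⟨(schwartzBlock ψ k u).continuous.locallyIntegrable, fun f => ⟨?_, ?_⟩⟩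
  · have := (SchwartzMap.smulLeftCLM ℂ (schwartzBlock ψ k u) f).integrable (μ := volume)
    refine this.congr (Filter.Eventually.of_forall fun x => ?_)
    simp only
    rw [SchwartzMap.smulLeftCLM_apply_apply (schwartzBlock ψ k u).hasTemperateGrowth, smul_eq_mul,
      mul_comm]
  · rw [dyadicBlock, TemperedDistribution.fourierMultiplierCLM_toTemperedDistributionCLM_eq
      (hasTemperateGrowth_dyadicSymbol hψ k)]
    rw [SchwartzMap.coe_apply]
    rfl

theorem schwartzBlock_eq (k : ℤ) (u : 𝓢(𝔼, ℂ)) :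
    schwartzBlock ψ k u =
      𝓕⁻ (SchwartzMap.smulLeftCLM ℂ (fun ξ => (dyadicSymbol ψ k ξ : ℂ)) (𝓕 u)) := rfl

theorem schwartzBlock_apply_eq_integral (hψ : IsCutoff ψ) (k : ℤ) (u : 𝓢(𝔼, ℂ)) (x : 𝔼) :
    schwartzBlock ψ k u x =
      ∫ z, u (x - z) * ((((2 : ℝ) ^ k) ^ n) • (𝓕⁻ (dyadicSchwartz hψ 0)) ((2 : ℝ) ^ k • z)) := by
  have h1 : schwartzBlock ψ k u x = 𝓕⁻ (fun ξ => dyadicSchwartz hψ k ξ * 𝓕 u ξ) x := by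
    rw [schwartzBlock_eq, SchwartzMap.fourierInv_coe]
    refine congrArg (fun g : 𝔼 → ℂ => 𝓕⁻ g x) (funext fun ξ => ?_)
    rw [SchwartzMap.smulLeftCLM_apply_apply (hasTemperateGrowth_dyadicSymbol hψ k)]
    rfl
  have h2 : ∀ z, 𝓕⁻ (dyadicSchwartz hψ k : 𝔼 → ℂ) z =
      (((2 : ℝ) ^ k) ^ n) • (𝓕⁻ (dyadicSchwartz hψ 0)) ((2 : ℝ) ^ k • z) := fun z => by
    rw [SchwartzMap.fourierInv_coe (dyadicSchwartz hψ 0), ← fourierInv_comp_two_zpow_smul]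
    refine congrArg (fun g : 𝔼 → ℂ => 𝓕⁻ g z) (funext fun ξ => ?_)
    simp [dyadicSymbol]
  rw [h1, SchwartzMap.fourier_coe, fourierInv_mul_fourier (u.integrable (μ := volume))
    ((dyadicSchwartz hψ k).integrable (μ := volume)),
    ← integral_sub_left_eq_self (fun z => u z * 𝓕⁻ (dyadicSchwartz hψ k : 𝔼 → ℂ) (x - z)) volume x]
  congr 1 with z
  rw [sub_sub_cancel, h2]

theorem integrable_one_add_pow_mul (f : 𝓢(𝔼, ℂ)) {c : ℝ} (hc : 0 ≤ c) (N : ℕ) :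
    Integrable fun z => (1 + c * ‖z‖) ^ N * ‖f z‖ := by
  have h1 := (f.integrable_pow_mul volume 0)
  have h2 := (f.integrable_pow_mul volume N)
  refine ((h1.add (h2.const_mul (c ^ N))).const_mul (2 ^ (N - 1))).mono'
    (by have := f.continuous; fun_prop) (Filter.Eventually.of_forall fun z => ?_)
  rw [Real.norm_of_nonneg (by positivity)]
  calc (1 + c * ‖z‖) ^ N * ‖f z‖ ≤ (2 ^ (N - 1) * (1 ^ N + (c * ‖z‖) ^ N)) * ‖f z‖ := by
        gcongr
        exact add_pow_le zero_le_one (by positivity) N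
    _ = _ := by simp only [Pi.add_apply]; ring

/-- Dyadic blocks of a wave packet decay at the scale of the width of the packet. -/
theorem exists_one_add_pow_mul_norm_schwartzBlock_le (hψ : IsCutoff ψ) (N M : ℕ) :
    ∃ C : ℝ≥0, ∀ (k : ℤ) (v : 𝔼) (t : ℝ) (ht : 0 < t), 1 / t ≤ 2 ^ M * 2 ^ k →
      ∀ x, (1 + ‖t⁻¹ • x‖) ^ N * ‖schwartzBlock ψ k (packet v t ht) x‖ ≤ C := by
  set Φ := 𝓕⁻ (dyadicSchwartz hψ 0)
  obtain ⟨Cb, hCb0, hCb⟩ : ∃ Cb : ℝ, 0 ≤ Cb ∧ ∀ y, (1 + ‖y‖) ^ N * ‖envelope n y‖ ≤ Cb := by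
    have h := fun y => SchwartzMap.one_add_le_sup_seminorm_apply (𝕜 := ℝ) (m := (N, 0)) (k := N)
      (n := 0) le_rfl le_rfl (envelope n) y
    simp only [norm_iteratedFDeriv_zero] at h
    exact ⟨_, le_trans (by positivity) (h 0), h⟩
  set I := ∫ z, (1 + 2 ^ M * ‖z‖) ^ N * ‖Φ z‖ with hI
  have hInt : Integrable fun z => (1 + 2 ^ M * ‖z‖) ^ N * ‖Φ z‖ :=
    integrable_one_add_pow_mul Φ (by positivity) N
  have hI0 : 0 ≤ I := by positivity
  refine ⟨(Cb * I).toNNReal, fun k v t ht htk x => ?_⟩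
  rw [Real.coe_toNNReal _ (by positivity)]
  have h2k : (0 : ℝ) < 2 ^ k := by positivity
  have hscale : ∫ z : 𝔼, ((2 : ℝ) ^ k) ^ n * ((1 + 2 ^ M * ‖(2 : ℝ) ^ k • z‖) ^ N *
      ‖Φ ((2 : ℝ) ^ k • z)‖) = I := by
    rw [integral_const_mul, Measure.integral_comp_smul volume
      (fun z => (1 + 2 ^ M * ‖z‖) ^ N * ‖Φ z‖), finrank_euclideanSpace_fin,
      abs_of_nonneg (by positivity), smul_eq_mul, mul_inv_cancel_left₀ (by positivity)]
  have hint2 : Integrable fun z : 𝔼 => ((2 : ℝ) ^ k) ^ n * ((1 + 2 ^ M * ‖(2 : ℝ) ^ k • z‖) ^ N *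
      ‖Φ ((2 : ℝ) ^ k • z)‖) := (hInt.comp_smul h2k.ne').const_mul _
  -- Peetre's inequality. As 1/t ≤ 2^M 2^k, the weight in z is absorbed by the kernel of Δ_k at its
  -- own scale, uniformly in k, v and t.
  have hpeetre : ∀ z, (1 + ‖t⁻¹ • x‖) ≤
      (1 + ‖t⁻¹ • (x - z)‖) * (1 + 2 ^ M * ‖(2 : ℝ) ^ k • z‖) := fun z => by
    have h1 : ‖t⁻¹ • z‖ ≤ 2 ^ M * ‖(2 : ℝ) ^ k • z‖ := by
      rw [norm_smul, norm_smul, ← mul_assoc, Real.norm_of_nonneg (by positivity),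
        Real.norm_of_nonneg h2k.le]
      rw [one_div] at htk
      gcongr
    have h2 : ‖t⁻¹ • x‖ ≤ ‖t⁻¹ • (x - z)‖ + ‖t⁻¹ • z‖ := by
      have := norm_add_le (t⁻¹ • (x - z)) (t⁻¹ • z)
      rwa [← smul_add, sub_add_cancel] at this
    have h3 : 0 ≤ ‖t⁻¹ • (x - z)‖ * (2 ^ M * ‖(2 : ℝ) ^ k • z‖) := by positivity
    linarith
  calc (1 + ‖t⁻¹ • x‖) ^ N * ‖schwartzBlock ψ k (packet v t ht) x‖
      ≤ (1 + ‖t⁻¹ • x‖) ^ N * ∫ z, ‖packet v t ht (x - z)‖ *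
          (((2 : ℝ) ^ k) ^ n * ‖Φ ((2 : ℝ) ^ k • z)‖) := by
        rw [schwartzBlock_apply_eq_integral hψ]
        gcongr
        refine (norm_integral_le_integral_norm _).trans_eq ?_
        congr 1 with z
        rw [norm_mul, norm_smul, Real.norm_of_nonneg (by positivity)]
    _ = ∫ z, (1 + ‖t⁻¹ • x‖) ^ N * (‖packet v t ht (x - z)‖ *
          (((2 : ℝ) ^ k) ^ n * ‖Φ ((2 : ℝ) ^ k • z)‖)) := by rw [integral_const_mul]
    _ ≤ ∫ z : 𝔼, Cb * (((2 : ℝ) ^ k) ^ n * ((1 + 2 ^ M * ‖(2 : ℝ) ^ k • z‖) ^ N *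
          ‖Φ ((2 : ℝ) ^ k • z)‖)) := by
        refine integral_mono_of_nonneg (Filter.Eventually.of_forall fun z => by positivity)
          (hint2.const_mul _) (Filter.Eventually.of_forall fun z => ?_)
        simp only
        rw [norm_packet_apply]
        calc (1 + ‖t⁻¹ • x‖) ^ N * (‖envelope n (t⁻¹ • (x - z))‖ *
              (((2 : ℝ) ^ k) ^ n * ‖Φ ((2 : ℝ) ^ k • z)‖))
            ≤ ((1 + ‖t⁻¹ • (x - z)‖) * (1 + 2 ^ M * ‖(2 : ℝ) ^ k • z‖)) ^ N *
              (‖envelope n (t⁻¹ • (x - z))‖ * (((2 : ℝ) ^ k) ^ n * ‖Φ ((2 : ℝ) ^ k • z)‖)) := by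
              gcongr
              exact hpeetre z
          _ = ((1 + ‖t⁻¹ • (x - z)‖) ^ N * ‖envelope n (t⁻¹ • (x - z))‖) *
              (((2 : ℝ) ^ k) ^ n * ((1 + 2 ^ M * ‖(2 : ℝ) ^ k • z‖) ^ N *
                ‖Φ ((2 : ℝ) ^ k • z)‖)) := by rw [mul_pow]; ring
          _ ≤ _ := by gcongr; exact hCb _
    _ = Cb * I := by rw [integral_const_mul, hscale]

/-- Pointwise decay of an order N for which (1 + |x|)^{-N} lies in L^r also covers r < 1, where
Young's inequality is not available. -/
theorem exists_eLpNorm_schwartzBlock_packet_le (hψ : IsCutoff ψ) (M : ℕ) (r : ℝ≥0∞) :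
    ∃ C : ℝ≥0, ∀ (k : ℤ) (v : 𝔼) (t : ℝ) (ht : 0 < t), 1 / t ≤ 2 ^ M * 2 ^ k →
      eLpNorm (schwartzBlock ψ k (packet v t ht)) r volume ≤
        C * ENNReal.ofReal t ^ (n * (r⁻¹).toReal) := by
  obtain ⟨N, hN⟩ := Measure.HasTemperateGrowth.exists_eLpNorm_lt_top r
    (μ := (volume : Measure 𝔼)) inferInstance
  obtain ⟨C, hC⟩ := exists_one_add_pow_mul_norm_schwartzBlock_le hψ N M
  set F : 𝔼 → ℂ := fun x => (((1 + ‖x‖) ^ (-N : ℝ) : ℝ) : ℂ) with hF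
  have hFc : Continuous F := Complex.continuous_ofReal.comp
    ((continuous_const.add continuous_norm).rpow_const
      fun x => Or.inl (by positivity : 0 < 1 + ‖x‖).ne')
  have hFn : eLpNorm F r volume = eLpNorm (fun x : 𝔼 => (1 + ‖x‖) ^ (-N : ℝ)) r volume :=
    eLpNorm_congr_norm_ae (Filter.Eventually.of_forall fun x => by
      simp only [hF, Complex.norm_real])
  have hFt : eLpNorm F r volume ≠ ∞ := by rw [hFn]; exact hN.ne
  refine ⟨C * (eLpNorm F r volume).toNNReal, fun k v t ht htk => ?_⟩
  have h1 : eLpNorm (schwartzBlock ψ k (packet v t ht)) r volume ≤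
      eLpNorm (fun x => ((C : ℝ) : ℂ) * F (t⁻¹ • x)) r volume := by
    refine eLpNorm_mono fun x => ?_
    have hx := hC k v t ht htk x
    have hpos : 0 < (1 + ‖t⁻¹ • x‖) ^ N := by positivity
    rw [norm_mul, Complex.norm_real, hF, Complex.norm_real, Real.norm_of_nonneg (by positivity),
      Real.norm_of_nonneg (by positivity), Real.rpow_neg (by positivity), Real.rpow_natCast,
      ← div_eq_mul_inv, le_div_iff₀ hpos, mul_comm]
    exact hx
  refine h1.trans_eq ?_
  have h2 := eLpNorm_const_smul ((C : ℝ) : ℂ) (fun x => F (t⁻¹ • x)) r volume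
  have h3 : (fun x => ((C : ℝ) : ℂ) * F (t⁻¹ • x)) = ((C : ℝ) : ℂ) • fun x => F (t⁻¹ • x) := rfl
  rw [h3, h2, eLpNorm_comp_inv_smul hFc.aestronglyMeasurable ht, ENNReal.coe_mul,
    ENNReal.coe_toNNReal hFt]
  have h4 : ‖((C : ℝ) : ℂ)‖ₑ = C := by
    rw [enorm_eq_nnnorm]
    congr 1
    ext
    simp
  rw [h4]
  ring

end Packet

/-! ### Lacunary sums of wave packets and their Besov norms. -/

section TestFunction

variable {n : ℕ} {ψ : EuclideanSpace ℝ (Fin n) → ℝ}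

local notation "𝔼" => EuclideanSpace ℝ (Fin n)

/-- Near a frequency of size `2 ^ j` only the symbols with index in a fixed window around `j` are
active, and they add up to one. -/
theorem exists_dyadic_window (hψ : IsCutoff ψ) :
    ∃ M : ℕ, ∀ (j : ℤ) (ξ : 𝔼), 2 ^ j / 2 ≤ ‖ξ‖ → ‖ξ‖ ≤ 2 * 2 ^ j →
      (∀ k : ℤ, M < |k - j| → dyadicSymbol ψ k ξ = 0) ∧
      ∑ l ∈ Finset.range (2 * M + 1), dyadicSymbol ψ (j - M + l) ξ = 1 := by
  obtain ⟨δ, hδ, hball⟩ := Metric.eventually_nhds_iff.1 hψ.eq_one_near_zero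
  obtain ⟨M₀, hM₀⟩ := pow_unbounded_of_one_lt (8 / δ) (one_lt_two : (1 : ℝ) < 2)
  -- Chosen so that 2^M ≥ 8 takes the low indices outside the support of ψ, and 2^M δ > 8 takes the
  -- high ones into the ball where ψ = 1. In between the symbols telescope.
  set M := M₀ + 3 with hM
  have hM1 : 8 ≤ (2 : ℝ) ^ M := by
    rw [hM, pow_add]
    have : (1 : ℝ) ≤ 2 ^ M₀ := one_le_pow₀ (by norm_num)
    linarith
  have hM2 : 8 < 2 ^ M * δ := by
    rw [div_lt_iff₀ hδ] at hM₀
    have : (2 : ℝ) ^ M₀ ≤ 2 ^ M := pow_le_pow_right₀ (by norm_num) (by omega)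
    nlinarith
  have hpos : (0 : ℝ) < 2 ^ M := by positivity
  refine ⟨M, fun j ξ h1 h2 => ?_⟩
  have hj : (0 : ℝ) < 2 ^ j := by positivity
  have hnorm : ∀ k : ℤ, ‖(2 : ℝ) ^ (-k) • ξ‖ = 2 ^ (j - k) * (‖ξ‖ / 2 ^ j) := fun k => by
    rw [norm_smul, Real.norm_of_nonneg (by positivity), zpow_sub₀ two_ne_zero, zpow_neg]
    field_simp
  have hy1 : 1 / 2 ≤ ‖ξ‖ / 2 ^ j := by rw [le_div_iff₀ hj]; linarith
  have hy2 : ‖ξ‖ / 2 ^ j ≤ 2 := by rw [div_le_iff₀ hj]; linarith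
  set y := ‖ξ‖ / 2 ^ j
  have hhigh : ∀ k : ℤ, k < j - M → ψ ((2 : ℝ) ^ (-k) • ξ) = 0 := fun k hk => by
    refine hψ.eq_zero ?_
    rw [hnorm]
    have : (2 : ℝ) ^ M ≤ 2 ^ (j - k) := by
      rw [← zpow_natCast]; exact zpow_le_zpow_right₀ (by norm_num) (by omega)
    nlinarith
  have hlow : ∀ k : ℤ, j + M ≤ k → ψ ((2 : ℝ) ^ (-k) • ξ) = 1 := fun k hk => by
    refine hball ?_
    rw [dist_zero_right, hnorm]
    have : (2 : ℝ) ^ (j - k) ≤ (2 ^ M)⁻¹ := by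
      rw [← zpow_natCast, ← zpow_neg]; exact zpow_le_zpow_right₀ (by norm_num) (by omega)
    calc (2 : ℝ) ^ (j - k) * y ≤ (2 ^ M)⁻¹ * 2 := by gcongr
      _ < δ := by rw [inv_mul_lt_iff₀ hpos]; linarith
  have hG : ∀ k : ℤ, dyadicSymbol ψ k ξ =
      ψ ((2 : ℝ) ^ (-k) • ξ) - ψ ((2 : ℝ) ^ (-(k - 1)) • ξ) := fun k => by
    rw [dyadicSymbol, smul_smul, ← zpow_one_add₀ two_ne_zero]
    congr 4
    ring
  refine ⟨fun k hk => ?_, ?_⟩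
  · rw [hG]
    rcases lt_abs.1 hk with h | h
    · rw [hlow _ (by omega), hlow _ (by omega), sub_self]
    · rw [hhigh _ (by omega), hhigh _ (by omega), sub_self]
  · have hs := Finset.sum_range_sub
      (fun l : ℕ => ψ ((2 : ℝ) ^ (-(j - M - 1 + l : ℤ)) • ξ)) (2 * M + 1)
    rw [hlow _ (by push_cast; omega), hhigh _ (by push_cast; omega), sub_zero] at hs
    rw [← hs]
    refine Finset.sum_congr rfl fun l _ => ?_
    rw [hG]
    congr 4
    · push_cast; ring
    · ring

/-- The bump has radius 1/(2t) ≤ 2^j / 2 and is centred at a point of norm 2^j. -/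
theorem packetSymbol_support {e : 𝔼} (he : ‖e‖ = 1) {j : ℤ} {t : ℝ} (ht : 0 < t)
    (htj : 1 / t ≤ 2 ^ j) {ξ : 𝔼} (h : packetSymbol ((2 : ℝ) ^ j • e) t ht ξ ≠ 0) :
    2 ^ j / 2 ≤ ‖ξ‖ ∧ ‖ξ‖ ≤ 2 * 2 ^ j := by
  have hj : (0 : ℝ) < 2 ^ j := by positivity
  have h1 : t * ‖ξ - (2 : ℝ) ^ j • e‖ < 1 / 2 := by
    by_contra! h'
    exact h (packetSymbol_eq_zero _ ht h')
  have h2 : ‖ξ - (2 : ℝ) ^ j • e‖ ≤ 2 ^ j / 2 := by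
    rw [div_le_iff₀ ht] at htj
    by_contra! h'
    nlinarith
  have h3 : ‖(2 : ℝ) ^ j • e‖ = 2 ^ j := by
    rw [norm_smul, he, mul_one, Real.norm_of_nonneg hj.le]
  have h4 := abs_le.1 ((abs_norm_sub_norm_le ξ ((2 : ℝ) ^ j • e)).trans h2)
  rw [h3] at h4
  constructor <;> linarith

/-- The window size of `exists_dyadic_window`. -/
def window (hψ : IsCutoff ψ) : ℕ := (exists_dyadic_window hψ).choose

theorem schwartzBlock_packet_eq_zero (hψ : IsCutoff ψ) {e : 𝔼} (he : ‖e‖ = 1) {j k : ℤ} {t : ℝ}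
    (ht : 0 < t) (htj : 1 / t ≤ 2 ^ j) (hk : window hψ < |k - j|) :
    schwartzBlock ψ k (packet ((2 : ℝ) ^ j • e) t ht) = 0 := by
  have h : SchwartzMap.smulLeftCLM ℂ (fun ξ => (dyadicSymbol ψ k ξ : ℂ))
      (packetSymbol ((2 : ℝ) ^ j • e) t ht) = 0 := by
    ext ξ
    rw [SchwartzMap.smulLeftCLM_apply_apply (hasTemperateGrowth_dyadicSymbol hψ k)]
    by_cases h0 : packetSymbol ((2 : ℝ) ^ j • e) t ht ξ = 0
    · simp [h0]
    · obtain ⟨h1, h2⟩ := packetSymbol_support he ht htj h0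
      simp [((exists_dyadic_window hψ).choose_spec j ξ h1 h2).1 k hk]
  rw [schwartzBlock_eq, packet, FourierTransform.fourier_fourierInv_eq, h]
  exact map_zero (FourierTransform.fourierInvCLM ℂ 𝓢(𝔼, ℂ))

/-- No single φ_k is known to be bounded below near the packet; only the window sum is, being 1.
Lower bounds therefore pass through this identity. -/
theorem sum_schwartzBlock_packet (hψ : IsCutoff ψ) {e : 𝔼} (he : ‖e‖ = 1) {j : ℤ} {t : ℝ}
    (ht : 0 < t) (htj : 1 / t ≤ 2 ^ j) :
    ∑ l ∈ Finset.range (2 * window hψ + 1),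
      schwartzBlock ψ (j - window hψ + l) (packet ((2 : ℝ) ^ j • e) t ht) =
        packet ((2 : ℝ) ^ j • e) t ht := by
  have h : ∑ l ∈ Finset.range (2 * window hψ + 1),
      SchwartzMap.smulLeftCLM ℂ (fun ξ => (dyadicSymbol ψ (j - window hψ + l) ξ : ℂ))
        (packetSymbol ((2 : ℝ) ^ j • e) t ht) = packetSymbol ((2 : ℝ) ^ j • e) t ht := by
    ext ξ
    rw [sum_apply]
    simp_rw [SchwartzMap.smulLeftCLM_apply_apply (hasTemperateGrowth_dyadicSymbol hψ _),
      smul_eq_mul]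
    by_cases h0 : packetSymbol ((2 : ℝ) ^ j • e) t ht ξ = 0
    · simp [h0]
    · obtain ⟨h1, h2⟩ := packetSymbol_support he ht htj h0
      rw [← Finset.sum_mul, ← Complex.ofReal_sum]
      have := ((exists_dyadic_window hψ).choose_spec j ξ h1 h2).2
      rw [window, this, Complex.ofReal_one, one_mul]
  calc _ = ∑ l ∈ Finset.range (2 * window hψ + 1), FourierTransform.fourierInvCLM ℂ 𝓢(𝔼, ℂ)
        (SchwartzMap.smulLeftCLM ℂ (fun ξ => (dyadicSymbol ψ (j - window hψ + l) ξ : ℂ))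
        (packetSymbol ((2 : ℝ) ^ j • e) t ht)) := by
        refine Finset.sum_congr rfl fun l _ => ?_
        rw [schwartzBlock_eq, packet, FourierTransform.fourier_fourierInv_eq]
        rfl
    _ = _ := by rw [← map_sum, h]; rfl

/-- Sum of wave packets with lacunary frequencies `2 ^ (L i)`, amplitudes `2 ^ γ i` and widths
`2 ^ (ρ i - L i)`, where `L` exceeds the size of the window. -/
def testFunction (hψ : IsCutoff ψ) (e : 𝔼) (J : Finset ℤ) (γ ρ : ℤ → ℝ) : 𝓢(𝔼, ℂ) :=
  ∑ i ∈ J, (((2 : ℝ) ^ γ i : ℝ) : ℂ) •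
    packet ((2 : ℝ) ^ (((2 * window hψ + 1 : ℕ) : ℤ) * i) • e)
      ((2 : ℝ) ^ (ρ i - (2 * window hψ + 1 : ℕ) * i)) (by positivity)

theorem one_div_width_le (L : ℕ) {ρ : ℝ} (hρ : 0 ≤ ρ) (i : ℤ) :
    1 / (2 : ℝ) ^ (ρ - L * i) ≤ 2 ^ ((L : ℤ) * i) := by
  rw [one_div, ← Real.rpow_neg (by norm_num), ← Real.rpow_intCast]
  refine Real.rpow_le_rpow_of_exponent_le (by norm_num) ?_
  push_cast
  linarith

/-- Windows of radius M around the multiples of 2M + 1 are disjoint, so a block sees at most one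
packet. -/
theorem schwartzBlock_testFunction (hψ : IsCutoff ψ) {e : 𝔼} (he : ‖e‖ = 1) {J : Finset ℤ}
    {γ ρ : ℤ → ℝ} (hρ : ∀ i ∈ J, 0 ≤ ρ i) {i : ℤ} (hi : i ∈ J) {k : ℤ}
    (hk : |k - ((2 * window hψ + 1 : ℕ) : ℤ) * i| ≤ window hψ) :
    schwartzBlock ψ k (testFunction hψ e J γ ρ) = (((2 : ℝ) ^ γ i : ℝ) : ℂ) •
      schwartzBlock ψ k (packet ((2 : ℝ) ^ (((2 * window hψ + 1 : ℕ) : ℤ) * i) • e)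
        ((2 : ℝ) ^ (ρ i - (2 * window hψ + 1 : ℕ) * i)) (by positivity)) := by
  rw [testFunction, map_sum, Finset.sum_eq_single_of_mem i hi, map_smul]
  intro i' hi' hne
  rw [map_smul, schwartzBlock_packet_eq_zero hψ he _ (one_div_width_le _ (hρ i' hi') i'), smul_zero]
  by_contra! h
  have h1 := abs_le.1 hk
  have h2 := abs_le.1 h
  push_cast at h1 h2
  rcases lt_or_gt_of_ne hne with h3 | h3
  · nlinarith
  · nlinarith

theorem schwartzBlock_testFunction_eq_zero (hψ : IsCutoff ψ) {e : 𝔼} (he : ‖e‖ = 1) {J : Finset ℤ}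
    {γ ρ : ℤ → ℝ} (hρ : ∀ i ∈ J, 0 ≤ ρ i) {k : ℤ}
    (hk : ∀ i ∈ J, window hψ < |k - ((2 * window hψ + 1 : ℕ) : ℤ) * i|) :
    schwartzBlock ψ k (testFunction hψ e J γ ρ) = 0 := by
  rw [testFunction, map_sum]
  refine Finset.sum_eq_zero fun i hi => ?_
  rw [map_smul, schwartzBlock_packet_eq_zero hψ he _ (one_div_width_le _ (hρ i hi) i) (hk i hi),
    smul_zero]

theorem ofReal_two_rpow (x : ℝ) : ENNReal.ofReal ((2 : ℝ) ^ x) = 2 ^ x := by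
  rw [← ENNReal.ofReal_rpow_of_pos (by norm_num)]; simp

theorem eLpNorm_two_rpow_smul (γ : ℝ) (f : 𝔼 → ℂ) (r : ℝ≥0∞) :
    eLpNorm ((((2 : ℝ) ^ γ : ℝ) : ℂ) • f) r volume = 2 ^ γ * eLpNorm f r volume := by
  rw [eLpNorm_const_smul, ← ofReal_two_rpow, ← ofReal_norm, Complex.norm_real,
    Real.norm_of_nonneg (by positivity)]

theorem two_rpow_mul_le {k j : ℤ} {M : ℕ} (h : |k - j| ≤ M) (σ : ℝ) :
    (2 : ℝ≥0∞) ^ (k * σ) ≤ 2 ^ (M * |σ|) * 2 ^ (j * σ) := by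
  rw [← ENNReal.rpow_add _ _ (by simp) (by simp)]
  refine ENNReal.rpow_le_rpow_of_exponent_le (by simp) ?_
  have h1 : |((k : ℝ) - j)| ≤ M := by exact_mod_cast h
  have h2 : ((k : ℝ) - j) * σ ≤ M * |σ| :=
    (le_abs_self _).trans (by rw [abs_mul]; gcongr)
  linarith

theorem exists_besovNorm_testFunction_le (hψ : IsCutoff ψ) (σ : ℝ) (r : ℝ≥0∞) :
    ∃ K : ℝ≥0, ∀ (e : 𝔼), ‖e‖ = 1 → ∀ (J : Finset ℤ) (γ ρ : ℤ → ℝ) (α : ℝ), (∀ i ∈ J, 0 ≤ ρ i) →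
      (∀ i ∈ J, (2 * window hψ + 1 : ℕ) * i * σ + γ i +
        (ρ i - (2 * window hψ + 1 : ℕ) * i) * (n * (r⁻¹).toReal) ≤ α) →
      besovNorm ψ σ r ∞ (testFunction hψ e J γ ρ : 𝓢'(𝔼, ℂ)) ≤ K * 2 ^ α := by
  obtain ⟨C, hC⟩ := exists_eLpNorm_schwartzBlock_packet_le hψ (window hψ) r
  set M := window hψ with hM
  have hKt : (2 : ℝ≥0∞) ^ (M * |σ|) ≠ ∞ := ENNReal.rpow_ne_top_of_nonneg (by positivity) (by simp)
  refine ⟨C * ((2 : ℝ≥0∞) ^ (M * |σ|)).toNNReal, fun e he J γ ρ α hρ hα => ?_⟩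
  rw [besovNorm, if_pos rfl, ENNReal.coe_mul, ENNReal.coe_toNNReal hKt]
  refine iSup_le fun k => ?_
  rw [(isRepresentedBy_schwartzBlock hψ k _).lpNorm_eq]
  by_cases hk : ∃ i ∈ J, |k - ((2 * M + 1 : ℕ) : ℤ) * i| ≤ M
  · obtain ⟨i, hi, hki⟩ := hk
    have h2k : 1 / (2 : ℝ) ^ (ρ i - (2 * M + 1 : ℕ) * i) ≤ 2 ^ M * 2 ^ k := by
      refine (one_div_width_le _ (hρ i hi) i).trans ?_
      rw [← zpow_natCast, ← zpow_add₀ two_ne_zero]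
      have := abs_le.1 hki
      exact zpow_le_zpow_right₀ (by norm_num) (by linarith)
    rw [schwartzBlock_testFunction hψ he hρ hi hki]
    have hco : ∀ (c : ℂ) (f : 𝓢(𝔼, ℂ)), ((c • f : 𝓢(𝔼, ℂ)) : 𝔼 → ℂ) = c • (f : 𝔼 → ℂ) :=
      fun c f => by ext x; simp
    rw [hco, eLpNorm_two_rpow_smul]
    calc _ ≤ ((2 : ℝ≥0∞) ^ (M * |σ|) * 2 ^ ((((2 * M + 1 : ℕ) : ℤ) * i : ℤ) * σ)) * (2 ^ γ i *
          ((C : ℝ≥0∞) * (2 ^ (ρ i - (2 * M + 1 : ℕ) * i)) ^ (n * (r⁻¹).toReal))) := by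
          gcongr
          · exact two_rpow_mul_le hki σ
          · rw [← ofReal_two_rpow]; exact hC k _ _ _ h2k
      _ = C * 2 ^ (M * |σ|) * (2 ^ ((((2 * M + 1 : ℕ) : ℤ) * i : ℤ) * σ) * 2 ^ γ i *
            2 ^ ((ρ i - (2 * M + 1 : ℕ) * i) * (n * (r⁻¹).toReal))) := by
          rw [← ENNReal.rpow_mul]; ring
      _ ≤ _ := by
          rw [← ENNReal.rpow_add _ _ (by simp) (by simp),
            ← ENNReal.rpow_add _ _ (by simp) (by simp)]
          gcongr
          · simp
          · have := hα i hi
            push_cast at this ⊢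
            exact this
  · push Not at hk
    rw [schwartzBlock_testFunction_eq_zero hψ he hρ hk]
    have : ((0 : 𝓢(𝔼, ℂ)) : 𝔼 → ℂ) = 0 := by ext x; simp
    simp [this]

/-- For p < 1 each addition costs a quasi-norm constant; this is harmless because m will be the
fixed window length. -/
theorem exists_eLpNorm_sum_le (p : ℝ≥0∞) (m : ℕ) :
    ∃ C : ℝ≥0, ∀ f : ℕ → 𝓢(𝔼, ℂ), eLpNorm (∑ l ∈ Finset.range m, f l : 𝓢(𝔼, ℂ)) p volume ≤
      C * ∑ l ∈ Finset.range m, eLpNorm (f l) p volume := by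
  induction m with
  | zero =>
    refine ⟨0, fun f => ?_⟩
    have : ((0 : 𝓢(𝔼, ℂ)) : 𝔼 → ℂ) = 0 := by ext x; simp
    simp [this]
  | succ m ih =>
    obtain ⟨C, hC⟩ := ih
    set c := (ENNReal.LpAddConst p).toNNReal
    have hc : ENNReal.LpAddConst p = c :=
      (ENNReal.coe_toNNReal (ENNReal.LpAddConst_lt_top p).ne).symm
    refine ⟨c * (C + 1), fun f => ?_⟩
    rw [Finset.sum_range_succ, Finset.sum_range_succ]
    have hco : ((∑ l ∈ Finset.range m, f l + f m : 𝓢(𝔼, ℂ)) : 𝔼 → ℂ) =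
        ((∑ l ∈ Finset.range m, f l : 𝓢(𝔼, ℂ)) : 𝔼 → ℂ) + f m := by ext x; simp
    rw [hco]
    refine (eLpNorm_add_le' (SchwartzMap.continuous _).aestronglyMeasurable
      (SchwartzMap.continuous _).aestronglyMeasurable p).trans ?_
    rw [hc, ENNReal.coe_mul, mul_assoc]
    gcongr
    calc _ ≤ C * ∑ l ∈ Finset.range m, eLpNorm (f l) p volume + eLpNorm (f m) p volume := by
          gcongr; exact hC f
      _ ≤ ((C + 1 : ℝ≥0) : ℝ≥0∞) * ∑ l ∈ Finset.range m, eLpNorm (f l) p volume +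
          ((C + 1 : ℝ≥0) : ℝ≥0∞) * eLpNorm (f m) p volume := by
          gcongr
          · simp
          · exact le_mul_of_one_le_left (by simp) (by simp)
      _ = _ := by ring

theorem exists_le_besovNorm_testFunction (hψ : IsCutoff ψ) (s : ℝ) {p q : ℝ≥0∞} (hp : 0 < p)
    (hq : 0 < q) (hq' : q < ∞) :
    ∃ K : ℝ≥0, ∀ (e : 𝔼), ‖e‖ = 1 → ∀ (J : Finset ℤ) (γ ρ : ℤ → ℝ) (ζ : ℝ), (∀ i ∈ J, 0 ≤ ρ i) →
      (∀ i ∈ J, ζ ≤ (2 * window hψ + 1 : ℕ) * i * s + γ i +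
        (ρ i - (2 * window hψ + 1 : ℕ) * i) * (n * (p⁻¹).toReal)) →
      (J.card : ℝ≥0∞) ^ (1 / q.toReal) * 2 ^ ζ ≤
        K * besovNorm ψ s p q (testFunction hψ e J γ ρ : 𝓢'(𝔼, ℂ)) := by
  set M := window hψ with hM
  obtain ⟨C, hC⟩ := exists_eLpNorm_sum_le (n := n) p (2 * M + 1)
  have hq0 : 0 < q.toReal := ENNReal.toReal_pos hq.ne' hq'.ne
  set b := eLpNorm (envelope n) p volume with hb
  have hb0 : b ≠ 0 := eLpNorm_envelope_ne_zero hp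
  have hbt : b ≠ ∞ := ((envelope n).eLpNorm_lt_top p volume).ne
  have hMt : (2 : ℝ≥0∞) ^ (M * |s|) ≠ ∞ := ENNReal.rpow_ne_top_of_nonneg (by positivity) (by simp)
  set K : ℝ≥0∞ := C * (2 * M + 1 : ℕ) * 2 ^ (M * |s|) / b with hK
  have hKt : K ≠ ∞ := ENNReal.div_ne_top
    (ENNReal.mul_ne_top (ENNReal.mul_ne_top (by simp) (ENNReal.natCast_ne_top _)) hMt) hb0
  refine ⟨K.toNNReal, fun e he J γ ρ ζ hρ hζ => ?_⟩
  rw [ENNReal.coe_toNNReal hKt]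
  set u := testFunction hψ e J γ ρ with hu
  set y : ℤ → ℝ≥0∞ := fun k => 2 ^ ((k : ℝ) * s) * eLpNorm (schwartzBlock ψ k u) p volume with hy
  have hnorm : besovNorm ψ s p q (u : 𝓢'(𝔼, ℂ)) = (∑' k, y k ^ q.toReal) ^ (1 / q.toReal) := by
    rw [besovNorm, if_neg hq'.ne]
    simp_rw [(isRepresentedBy_schwartzBlock hψ _ u).lpNorm_eq]
    rfl
  -- The largest term in the window of i carries a fixed fraction of the packet. Disjointness of the
  -- windows makes the choice injective, so the ℓ^q sum has at least |J| terms of this size.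
  have hpick : ∀ i ∈ J, ∃ k : ℤ, |k - ((2 * M + 1 : ℕ) : ℤ) * i| ≤ M ∧ 2 ^ ζ ≤ K * y k := by
    intro i hi
    set j : ℤ := ((2 * M + 1 : ℕ) : ℤ) * i with hj
    have hwin : ∀ l ∈ Finset.range (2 * M + 1), |(j - M + l : ℤ) - j| ≤ M := fun l hl => by
      rw [Finset.mem_range] at hl
      rw [abs_le]; constructor <;> omega
    have hsum : ∑ l ∈ Finset.range (2 * M + 1), schwartzBlock ψ (j - M + l) u =
        (((2 : ℝ) ^ γ i : ℝ) : ℂ) • packet ((2 : ℝ) ^ j • e)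
          ((2 : ℝ) ^ (ρ i - (2 * M + 1 : ℕ) * i)) (by positivity) := by
      rw [← sum_schwartzBlock_packet hψ he _ (one_div_width_le _ (hρ i hi) i), Finset.smul_sum]
      exact Finset.sum_congr rfl fun l hl => schwartzBlock_testFunction hψ he hρ hi (hwin l hl)
    have hle := hC fun l => schwartzBlock ψ (j - M + l) u
    rw [hsum] at hle
    have hco : ∀ (c : ℂ) (f : 𝓢(𝔼, ℂ)), ((c • f : 𝓢(𝔼, ℂ)) : 𝔼 → ℂ) = c • (f : 𝔼 → ℂ) :=
      fun c f => by ext x; simp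
    rw [hco, eLpNorm_two_rpow_smul, eLpNorm_packet, ofReal_two_rpow, ← hb] at hle
    obtain ⟨l₀, hl₀, hmax⟩ := Finset.exists_max_image (Finset.range (2 * M + 1))
      (fun l : ℕ => y (j - M + l)) ⟨0, by simp⟩
    refine ⟨j - M + l₀, hwin l₀ hl₀, ?_⟩
    have hkey : 2 ^ ζ * b ≤ C * (2 * M + 1 : ℕ) * 2 ^ (M * |s|) * y (j - M + l₀) := by
      calc 2 ^ ζ * b ≤ 2 ^ ((j : ℝ) * s) * 2 ^ γ i *
            2 ^ ((ρ i - (2 * M + 1 : ℕ) * i) * (n * (p⁻¹).toReal)) * b := by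
            rw [← ENNReal.rpow_add _ _ (by simp) (by simp),
              ← ENNReal.rpow_add _ _ (by simp) (by simp)]
            gcongr
            · simp
            · have := hζ i hi
              rw [hj]
              push_cast at this ⊢
              exact this
        _ = 2 ^ ((j : ℝ) * s) * (2 ^ γ i *
            ((2 ^ (ρ i - (2 * M + 1 : ℕ) * i)) ^ (n * (p⁻¹).toReal) * b)) := by
            rw [← ENNReal.rpow_mul]; ring
        _ ≤ 2 ^ ((j : ℝ) * s) * (C * ∑ l ∈ Finset.range (2 * M + 1),
            eLpNorm (schwartzBlock ψ (j - M + l) u) p volume) := by gcongr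
        _ = C * ∑ l ∈ Finset.range (2 * M + 1), 2 ^ ((j : ℝ) * s) *
            eLpNorm (schwartzBlock ψ (j - M + l) u) p volume := by
            rw [Finset.mul_sum, Finset.mul_sum, Finset.mul_sum]
            exact Finset.sum_congr rfl fun l _ => by ring
        _ ≤ C * ∑ l ∈ Finset.range (2 * M + 1), 2 ^ (M * |s|) * y (j - M + l₀) := by
            refine mul_le_mul_right (Finset.sum_le_sum fun l hl => ?_) _
            calc _ ≤ 2 ^ (M * |s|) * 2 ^ (((j - M + l : ℤ) : ℝ) * s) *
                  eLpNorm (schwartzBlock ψ (j - M + l) u) p volume := by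
                  exact mul_le_mul_left
                    (two_rpow_mul_le (by rw [abs_sub_comm]; exact hwin l hl) s) _
              _ = 2 ^ (M * |s|) * y (j - M + l) := by rw [hy, mul_assoc]
              _ ≤ _ := mul_le_mul_right (hmax l hl) _
        _ = _ := by
            rw [Finset.sum_const, Finset.card_range, nsmul_eq_mul]; ring
    rw [hK, ENNReal.mul_comm_div, ← mul_div_assoc,
      ENNReal.le_div_iff_mul_le (Or.inl hb0) (Or.inl hbt)]
    exact hkey
  choose! κ hκ1 hκ2 using hpick
  have hinj : Set.InjOn κ J := by
    intro i hi i' hi' h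
    have h1 := abs_le.1 (hκ1 i hi)
    have h2 := abs_le.1 (hκ1 i' hi')
    rw [h] at h1
    push_cast at h1 h2
    by_contra hne
    rcases lt_or_gt_of_ne hne with h3 | h3 <;> nlinarith
  rw [hnorm]
  have hsum : (J.card : ℝ≥0∞) * (2 ^ ζ) ^ q.toReal ≤ K ^ q.toReal * ∑' k, y k ^ q.toReal := by
    calc (J.card : ℝ≥0∞) * (2 ^ ζ) ^ q.toReal = ∑ i ∈ J, (2 ^ ζ : ℝ≥0∞) ^ q.toReal := by
          rw [Finset.sum_const, nsmul_eq_mul]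
      _ ≤ ∑ i ∈ J, (K * y (κ i)) ^ q.toReal := by
          gcongr with i hi
          exact hκ2 i hi
      _ = K ^ q.toReal * ∑ i ∈ J, y (κ i) ^ q.toReal := by
          rw [Finset.mul_sum]
          exact Finset.sum_congr rfl fun i _ => ENNReal.mul_rpow_of_nonneg _ _ hq0.le
      _ = K ^ q.toReal * ∑ k ∈ J.image κ, y k ^ q.toReal := by rw [Finset.sum_image hinj]
      _ ≤ _ := by gcongr; exact ENNReal.sum_le_tsum _
  have := ENNReal.rpow_le_rpow hsum (show 0 ≤ 1 / q.toReal by positivity)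
  rw [ENNReal.mul_rpow_of_nonneg _ _ (by positivity),
    ENNReal.mul_rpow_of_nonneg _ _ (by positivity),
    ← ENNReal.rpow_mul _ q.toReal, ← ENNReal.rpow_mul _ q.toReal, mul_one_div_cancel hq0.ne',
    ENNReal.rpow_one, ENNReal.rpow_one] at this
  exact this

end TestFunction

/-! ### The inequality implies the four conditions. -/

section Necessity

variable {n : ℕ} {ψ : EuclideanSpace ℝ (Fin n) → ℝ}

local notation "𝔼" => EuclideanSpace ℝ (Fin n)

/-- The interpolation inequality, evaluated on the test functions, as an inequality between
exponents of two. -/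
theorem exists_exponent_bound (hψ : IsCutoff ψ) (hn : 1 ≤ n) {p q : ℝ≥0∞} (hp : 0 < p) (hq : 0 < q)
    (hq' : q < ∞) {p₀ p₁ : ℝ≥0∞} {θ s s₀ s₁ : ℝ} (hθ : 0 < θ) (hθ' : θ < 1)
    (hA : ∃ C : ℝ≥0, ∀ u : 𝓢'(𝔼, ℂ), MemBesov ψ s₀ p₀ ∞ u → MemBesov ψ s₁ p₁ ∞ u →
      besovNorm ψ s p q u ≤
        C * besovNorm ψ s₀ p₀ ∞ u ^ (1 - θ) * besovNorm ψ s₁ p₁ ∞ u ^ θ) :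
    ∃ κ : ℝ, ∀ (J : Finset ℤ) (γ ρ : ℤ → ℝ) (α β ζ : ℝ), (∀ i ∈ J, 0 ≤ ρ i) →
      (∀ i ∈ J, (2 * window hψ + 1 : ℕ) * i * s₀ + γ i +
        (ρ i - (2 * window hψ + 1 : ℕ) * i) * (n * (p₀⁻¹).toReal) ≤ α) →
      (∀ i ∈ J, (2 * window hψ + 1 : ℕ) * i * s₁ + γ i +
        (ρ i - (2 * window hψ + 1 : ℕ) * i) * (n * (p₁⁻¹).toReal) ≤ β) →
      (∀ i ∈ J, ζ ≤ (2 * window hψ + 1 : ℕ) * i * s + γ i +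
        (ρ i - (2 * window hψ + 1 : ℕ) * i) * (n * (p⁻¹).toReal)) →
      (J.card : ℝ≥0∞) ^ (1 / q.toReal) * 2 ^ ζ ≤ 2 ^ (κ + (1 - θ) * α + θ * β) := by
  obtain ⟨C, hC⟩ := hA
  obtain ⟨K₀, hK₀⟩ := exists_besovNorm_testFunction_le hψ s₀ p₀
  obtain ⟨K₁, hK₁⟩ := exists_besovNorm_testFunction_le hψ s₁ p₁
  obtain ⟨K, hK⟩ := exists_le_besovNorm_testFunction hψ s hp hq hq'
  have hθ1 : 0 ≤ 1 - θ := by linarith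
  obtain ⟨κ, hκ⟩ : ∃ κ : ℝ, (K : ℝ≥0∞) * (C * K₀ ^ (1 - θ) * K₁ ^ θ) ≤ 2 ^ κ := by
    set D : ℝ≥0 := K * (C * K₀ ^ (1 - θ) * K₁ ^ θ)
    have hD : (K : ℝ≥0∞) * (C * K₀ ^ (1 - θ) * K₁ ^ θ) = D := by
      simp [D, ENNReal.coe_rpow_of_nonneg _ hθ1, ENNReal.coe_rpow_of_nonneg _ hθ.le]
    obtain ⟨m, hm⟩ := pow_unbounded_of_one_lt D (one_lt_two : (1 : ℝ≥0) < 2)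
    refine ⟨m, ?_⟩
    rw [hD, ENNReal.rpow_natCast]
    exact_mod_cast hm.le
  refine ⟨κ, fun J γ ρ α β ζ hρ hα hβ hζ => ?_⟩
  obtain ⟨e, he⟩ : ∃ e : 𝔼, ‖e‖ = 1 := ⟨EuclideanSpace.single ⟨0, hn⟩ 1, by simp⟩
  have h0 := hK₀ e he J γ ρ α hρ hα
  have h1 := hK₁ e he J γ ρ β hρ hβ
  have h2 := hK e he J γ ρ ζ hρ hζ
  have ht : ∀ x : ℝ, (2 : ℝ≥0∞) ^ x ≠ ∞ := fun x => by simp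
  have hm0 : MemBesov ψ s₀ p₀ ∞ (testFunction hψ e J γ ρ : 𝓢'(𝔼, ℂ)) :=
    h0.trans_lt (ENNReal.mul_lt_top (by simp) (ht α).lt_top)
  have hm1 : MemBesov ψ s₁ p₁ ∞ (testFunction hψ e J γ ρ : 𝓢'(𝔼, ℂ)) :=
    h1.trans_lt (ENNReal.mul_lt_top (by simp) (ht β).lt_top)
  calc _ ≤ _ := h2
    _ ≤ K * (C * (K₀ * 2 ^ α) ^ (1 - θ) * (K₁ * 2 ^ β) ^ θ) := by
        refine mul_le_mul_right ((hC _ hm0 hm1).trans ?_) _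
        gcongr
    _ = (K * (C * K₀ ^ (1 - θ) * K₁ ^ θ)) * (2 ^ ((1 - θ) * α) * 2 ^ (θ * β)) := by
        rw [ENNReal.mul_rpow_of_nonneg _ _ hθ1, ENNReal.mul_rpow_of_nonneg _ _ hθ.le,
          ← ENNReal.rpow_mul, ← ENNReal.rpow_mul, mul_comm α, mul_comm β]
        ring
    _ ≤ 2 ^ κ * (2 ^ ((1 - θ) * α) * 2 ^ (θ * β)) := by gcongr
    _ = _ := by
        rw [← mul_assoc, ← ENNReal.rpow_add _ _ (by simp) (by simp),
          ← ENNReal.rpow_add _ _ (by simp) (by simp)]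

theorem not_forall_natCast_rpow_le {t : ℝ} (ht : 0 < t) (κ : ℝ)
    (h : ∀ N : ℕ, (N : ℝ≥0∞) ^ t ≤ 2 ^ κ) : False := by
  have hfin : ((2 : ℝ≥0∞) ^ κ) ^ t⁻¹ ≠ ∞ := ENNReal.rpow_ne_top_of_nonneg (by positivity) (by simp)
  obtain ⟨N, hN⟩ := ENNReal.exists_nat_gt hfin
  exact absurd ((ENNReal.le_rpow_inv_iff ht).2 (h N)) (not_le.2 hN)

/-- Only the bookkeeping of exponents remains: L i is the logarithm of the frequency, γ i that of
the amplitude, ρ i that of width times frequency. -/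
theorem conditions_of_exponent_bound {L n a a₀ a₁ s s₀ s₁ θ t κ : ℝ} (hL : 0 < L) (hn : 0 < n)
    (ht : 0 < t)
    (h : ∀ (J : Finset ℤ) (γ ρ : ℤ → ℝ) (α β ζ : ℝ), (∀ i ∈ J, 0 ≤ ρ i) →
      (∀ i ∈ J, L * i * s₀ + γ i + (ρ i - L * i) * (n * a₀) ≤ α) →
      (∀ i ∈ J, L * i * s₁ + γ i + (ρ i - L * i) * (n * a₁) ≤ β) →
      (∀ i ∈ J, ζ ≤ L * i * s + γ i + (ρ i - L * i) * (n * a)) →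
      (J.card : ℝ≥0∞) ^ t * 2 ^ ζ ≤ 2 ^ (κ + (1 - θ) * α + θ * β)) :
    n * a - s = (1 - θ) * (n * a₀ - s₀) + θ * (n * a₁ - s₁) ∧ s₀ - n * a₀ ≠ s₁ - n * a₁ ∧
      s ≤ (1 - θ) * s₀ + θ * s₁ ∧ (s = (1 - θ) * s₀ + θ * s₁ → a₀ = a₁) := by
  have hsingle : ∀ (i : ℤ) (r : ℝ), 0 ≤ r → L * i * s + (r - L * i) * (n * a) ≤
      κ + (1 - θ) * (L * i * s₀ + (r - L * i) * (n * a₀)) +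
        θ * (L * i * s₁ + (r - L * i) * (n * a₁)) := by
    intro i r hr
    have := h {i} 0 (fun _ => r) (L * i * s₀ + (r - L * i) * (n * a₀))
      (L * i * s₁ + (r - L * i) * (n * a₁)) (L * i * s + (r - L * i) * (n * a))
      (by simpa using hr) (by simp) (by simp) (by simp)
    simp only [Finset.card_singleton, Nat.cast_one, ENNReal.one_rpow, one_mul] at this
    by_contra! hlt
    exact absurd this (not_le.2 (ENNReal.rpow_lt_rpow_of_exponent_lt (by simp) (by simp) hlt))
  -- One packet with ρ = 0: the bound is linear in the frequency index i ∈ ℤ, so its slope must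
  -- vanish.
  have hscale : n * a - s = (1 - θ) * (n * a₀ - s₀) + θ * (n * a₁ - s₁) := by
    by_contra hne
    set x := (1 - θ) * (n * a₀ - s₀) + θ * (n * a₁ - s₁) - (n * a - s) with hx
    have hx0 : x ≠ 0 := fun h => hne (by linarith)
    have hbd : ∀ i : ℤ, (i : ℝ) * (L * x) ≤ κ := fun i => by
      have := hsingle i 0 le_rfl
      rw [hx]
      linarith
    obtain ⟨m, hm⟩ := exists_nat_gt (κ / |L * x|)
    have hpos : 0 < |L * x| := abs_pos.2 (mul_ne_zero hL.ne' hx0)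
    rw [div_lt_iff₀ hpos] at hm
    rcases abs_cases (L * x) with ⟨h1, -⟩ | ⟨h1, -⟩
    · have := hbd m
      push_cast at this
      rw [h1] at hm
      linarith
    · have := hbd (-m)
      push_cast at this
      rw [h1] at hm
      linarith
  -- One packet of frequency 1 and growing width: a positive slope in the logarithmic width would
  -- contradict the bound.
  have hle : s ≤ (1 - θ) * s₀ + θ * s₁ := by
    by_contra! hlt
    set x := n * a - (1 - θ) * (n * a₀) - θ * (n * a₁) with hx
    have hx0 : 0 < x := by linarith
    have := hsingle 0 ((|κ| + 1) / x) (by positivity)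
    simp only [Int.cast_zero, mul_zero, zero_mul, zero_add, sub_zero] at this
    have h2 : (|κ| + 1) / x * x ≤ κ := by
      rw [hx]
      linarith
    rw [div_mul_cancel₀ _ hx0.ne'] at h2
    linarith [le_abs_self κ]
  refine ⟨hscale, fun hd => ?_, hle, fun hs => ?_⟩
  -- If both endpoint spaces scale alike, so does the target; amplitudes L i (n a₀ - s₀) then give
  -- every packet exponent 0 in all three norms.
  · refine not_forall_natCast_rpow_le ht κ fun N => ?_
    have := h ((Finset.range N).map Nat.castEmbedding) (fun i => L * i * (n * a₀ - s₀)) 0 0 0 0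
      (by simp)
      (fun i _ => by simp only [Pi.zero_apply]; linarith)
      (fun i _ => by
        have h1 : n * a₀ - s₀ = n * a₁ - s₁ := by linarith
        simp only [Pi.zero_apply]; rw [h1]; linarith)
      (fun i _ => by
        have h1 : n * a₁ - s₁ = n * a₀ - s₀ := by linarith
        have h2 : n * a - s = n * a₀ - s₀ := by rw [hscale, h1]; ring
        simp only [Pi.zero_apply]; rw [← h2]; linarith)
    simpa using this
  · by_contra hne
    have hd0 : n * (a₀ - a₁) ≠ 0 := mul_ne_zero hn.ne' (sub_ne_zero.2 hne)
    -- With ρ i = L i c each packet has equal exponents in the two endpoint norms, and γ brings both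
    -- to 0. As s and a are the same convex combinations of the endpoint values, the target exponent
    -- is 0 too.
    set c := ((n * a₀ - s₀) - (n * a₁ - s₁)) / (n * (a₀ - a₁)) with hc
    have hc' : c * (n * (a₀ - a₁)) = (n * a₀ - s₀) - (n * a₁ - s₁) := div_mul_cancel₀ _ hd0
    -- The sign of ε sends the frequencies to infinity or to zero, whichever keeps ρ i = L i c
    -- nonnegative.
    obtain ⟨ε, hε0, hε⟩ : ∃ ε : ℤ, ε ≠ 0 ∧ 0 ≤ ε * c := by
      rcases le_total 0 c with h1 | h1
      · exact ⟨1, one_ne_zero, by simpa using h1⟩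
      · exact ⟨-1, by norm_num, by simpa using h1⟩
    have hna : n * a = (1 - θ) * (n * a₀) + θ * (n * a₁) := by linarith
    refine not_forall_natCast_rpow_le ht κ fun N => ?_
    have hinj : Function.Injective fun m : ℕ => ε * (m : ℤ) := fun m m' hm => by
      exact_mod_cast mul_left_cancel₀ hε0 hm
    have := h ((Finset.range N).image fun m : ℕ => ε * (m : ℤ))
      (fun i => -(L * i * s₀ + (L * i * c - L * i) * (n * a₀))) (fun i => L * i * c) 0 0 0
      (fun i hi => by
        obtain ⟨m, -, rfl⟩ := Finset.mem_image.1 hi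
        have : 0 ≤ L * m * (ε * c) := by positivity
        push_cast
        linarith)
      (fun i _ => by linarith)
      (fun i _ => by
        have : L * i * s₁ + -(L * i * s₀ + (L * i * c - L * i) * (n * a₀)) +
            (L * i * c - L * i) * (n * a₁) =
            L * i * ((n * a₀ - s₀) - (n * a₁ - s₁) - c * (n * (a₀ - a₁))) := by ring
        rw [this, hc']
        simp)
      (fun i _ => by
        have : L * i * s + -(L * i * s₀ + (L * i * c - L * i) * (n * a₀)) +
            (L * i * c - L * i) * (n * a) =
            θ * (L * i * ((n * a₀ - s₀) - (n * a₁ - s₁) - c * (n * (a₀ - a₁)))) := by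
          rw [hna, hs]; ring
        rw [this, hc']
        simp)
    rw [Finset.card_image_of_injective _ hinj] at this
    simpa using this

end Necessity

end Besov

end

theorem theorem1p3 (n : ℕ) (hn : 1 ≤ n)
    (ψ : EuclideanSpace ℝ (Fin n) → ℝ) (hψ : Besov.IsCutoff ψ)
    (p p₀ p₁ q : ℝ≥0∞) (hp : 0 < p) (hp₀ : 0 < p₀) (hp₁ : 0 < p₁) (hq : 0 < q) (hq' : q < ∞)
    (θ : ℝ) (hθ : 0 < θ) (hθ' : θ < 1) (s s₀ s₁ : ℝ) :
    (∃ C : ℝ≥0, ∀ u : 𝓢'(EuclideanSpace ℝ (Fin n), ℂ),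
        Besov.MemBesov ψ s₀ p₀ ∞ u → Besov.MemBesov ψ s₁ p₁ ∞ u →
          Besov.besovNorm ψ s p q u ≤
            C * Besov.besovNorm ψ s₀ p₀ ∞ u ^ (1 - θ) * Besov.besovNorm ψ s₁ p₁ ∞ u ^ θ) ↔
      ((n / p : ℝ≥0∞).toReal - s =
          (1 - θ) * ((n / p₀ : ℝ≥0∞).toReal - s₀) + θ * ((n / p₁ : ℝ≥0∞).toReal - s₁) ∧
        s₀ - (n / p₀ : ℝ≥0∞).toReal ≠ s₁ - (n / p₁ : ℝ≥0∞).toReal ∧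
        s ≤ (1 - θ) * s₀ + θ * s₁ ∧
        (s = (1 - θ) * s₀ + θ * s₁ → p₀ = p₁)) := by
  have hdiv : ∀ r : ℝ≥0∞, (n / r : ℝ≥0∞).toReal = n * (r⁻¹).toReal := fun r => by
    rw [div_eq_mul_inv, ENNReal.toReal_mul, ENNReal.toReal_natCast]
  rw [hdiv, hdiv, hdiv]
  constructor
  · intro hA
    obtain ⟨κ, hκ⟩ := Besov.exists_exponent_bound hψ hn hp hq hq' hθ hθ' hA
    obtain ⟨h1, h2, h3, h4⟩ := Besov.conditions_of_exponent_bound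
      (by positivity) (by exact_mod_cast hn)
      (one_div_pos.2 (ENNReal.toReal_pos hq.ne' hq'.ne)) hκ
    exact ⟨h1, h2, h3, fun h => Besov.eq_of_toReal_inv_eq hp₀ hp₁ (h4 h)⟩
  · rintro ⟨h1, h2, h3, h4⟩
    exact Besov.exists_interpolation_bound hψ hn hp hp₀ hp₁ hq hq' hθ hθ' h1 h2 h3 h4
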